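/- Let $N\ge 0$ and let $\mathbf m:\mathbb R\times\mathbb R\to\mathbb S^2\subset\mathbb R^3$ solve the half-wave maps equation $$\partial_t \mathbf m=\mathbf m\times|\nabla|\mathbf m,\qquad |\nabla|=\mathcal H\partial_x,\qquad \mathcal Hf(x)=\mathrm{P.V.}\,\frac1\pi\int_{\mathbb R}\frac{f(y)}{x-y}\,dy,$$ for all times $t\in\mathbb R$. Suppose that $\mathbf m$ is rational, that is, for all $t$ and $x$, $$\mathbf m(t,x)=\mathbf m_0+\sum_{j=1}^N\frac{\mathbf s_j(t)}{x-x_j(t)}+\sum_{j=1}^N\frac{\overline{\mathbf s_j(t)}}{x-\overline{x_j(t)}},$$ where $\mathbf m_0\in\mathbb R^3$ and $\mathbf s_j:\mathbb R\to\mathbb C^3$, $x_j:\mathbb R\to\mathbb C$ are differentiable, $\operatorname{Im}x_j(t)>0$, and $x_j(t)\ne x_k(t)$ for $j\ne k$. Let $v\in\mathbb R$ and let $$G(t,x)=\mathbf m_0+Q_v(x-tv)+\overline{Q_v(x-tv)},\qquad Q_v(z)=\sum_{j=1}^N\frac{\mathbf c_j}{z-y_j},$$ be a travelling wave with nonzero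 $\mathbf c_j\in\mathbb C^3$ and distinct poles $y_j$ with $\operatorname{Im}y_j>0$. Assume that $$\|\mathbf m(t,\cdot)-G(t,\cdot)\|_{\dot H^{1/2}(\mathbb R)}\to0\quad\text{as }t\to+\infty,\qquad \|f\|_{\dot H^{1/2}}^2=\int_{\mathbb R}|\hat f(\xi)|^2|\xi|\,d\xi,$$ with $\hat f(\xi)=(2\pi)^{-1/2}\int_{\mathbb R} e^{-ix\xi}f(x)\,dx$, extended to $L^2$. Then $\mathbf m$ is a travelling wave at all times: $\mathbf m(t,x)=\mathbf m(0,x-tv)$ for all $t,x\in\mathbb R$. Moreover, write $a\cdot b=\sum_{i=1}^3a_ib_i$ (no conjugation), let $\varepsilon_{ij}\in\{1,-1\}$ be any signs and let $\sqrt{-2\,\mathbf s_i(t)\cdot\mathbf s_j(t)}$ denote any choice of the complex square roots. Define $X(t)=\operatorname{Diag}(x_1(t),\dots,x_N(t))$ and the $N\times N$ matrices with diagonal entries $$L_{ii}(t)=\dot x_i(t),\qquad B_{ii}(t)=0,\qquad S_{ii}(t)=0,$$ and, for $i\ne j$, $$L_{ij}(t)=\varepsilon_{ij}\frac{\sqrt{-2\,\mathbf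 s_i(t)\cdot\mathbf s_j(t)}}{x_i(t)-x_j(t)},\qquad B_{ij}(t)=\varepsilon_{ij}\frac{\sqrt{-2\,\mathbf s_i(t)\cdot\mathbf s_j(t)}}{(x_i(t)-x_j(t))^2},\qquad S_{ij}(t)=\sqrt{-2\,\mathbf s_i(t)\cdot\mathbf s_j(t)}.$$ Then for every $t\in\mathbb R$ $$L(t)=vI_N,\qquad B(t)=0,\qquad \dot X(t)=vI_N,\qquad S(t)=0.$$ -/

import Mathlib

open MeasureTheory Filter Topology Matrix
open scoped FourierTransform ENNReal ComplexConjugate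

noncomputable section

/-- `h` is the value at `x` of the Hilbert transform
`H f (x) = P.V. (1/π) ∫ f(y) / (x - y) dy` of the vector field `f`. -/
def HasHilbertTransformAt (f : ℝ → Fin 3 → ℝ) (h : Fin 3 → ℝ) (x : ℝ) : Prop :=
  (∀ ε : ℝ, 0 < ε → IntegrableOn (fun y => (x - y)⁻¹ • f y) {y | ε < |x - y|}) ∧
    Tendsto (fun ε : ℝ => (Real.pi)⁻¹ • ∫ y in {y | ε < |x - y|}, (x - y)⁻¹ • f y)
      (𝓝[>] 0) (𝓝 h)

/-- `m : ℝ × ℝ → 𝕊²` solves the half-wave maps equation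
`∂ₜ m = m × |∇| m`, where `|∇| m = H (∂ₓ m)`, at all times. -/
structure IsHalfWaveMap (m : ℝ → ℝ → Fin 3 → ℝ) : Prop where
  sphere : ∀ t x, m t x ⬝ᵥ m t x = 1
  differentiable_space : ∀ t, Differentiable ℝ (m t)
  evolution : ∀ t x, ∃ w : Fin 3 → ℝ,
    HasHilbertTransformAt (deriv (m t)) w x ∧
      HasDerivAt (fun τ => m τ x) (m t x ⨯₃ w) t

/-- The rational function
`x ↦ m₀ + ∑ⱼ sⱼ / (x - pⱼ) + ∑ⱼ conj sⱼ / (x - conj pⱼ)` with values in `ℂ³`. -/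
def rationalMap {N : ℕ} (m₀ : Fin 3 → ℝ) (s : Fin N → Fin 3 → ℂ) (p : Fin N → ℂ)
    (x : ℝ) : Fin 3 → ℂ := fun i =>
  (m₀ i : ℂ) + ∑ j, s j i / ((x : ℂ) - p j) + ∑ j, conj (s j i) / ((x : ℂ) - conj (p j))

/-- `m` is a rational solution of the half-wave maps equation, with spins `s j t` and
pairwise distinct poles `p j t` in the upper half plane, all of them differentiable in time. -/
structure IsRationalSolution {N : ℕ} (m : ℝ → ℝ → Fin 3 → ℝ) (m₀ : Fin 3 → ℝ)
    (s : Fin N → ℝ → Fin 3 → ℂ) (p : Fin N → ℝ → ℂ) : Prop where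
  solution : IsHalfWaveMap m
  spin_differentiable : ∀ j, Differentiable ℝ (s j)
  pole_differentiable : ∀ j, Differentiable ℝ (p j)
  pole_im_pos : ∀ j t, 0 < (p j t).im
  pole_injective : ∀ t, Function.Injective (fun j => p j t)
  rational : ∀ t x i, (m t x i : ℂ) = rationalMap m₀ (fun j => s j t) (fun j => p j t) x i

open Classical in
/-- `‖f‖²` in `Ḣ^{1/2}(ℝ)`, i.e. `∫ |f̂(ξ)|² |ξ| dξ` with
`f̂(ξ) = (2π)^{-1/2} ∫ e^{-ixξ} f(x) dx`, for `f` in `L²(ℝ; ℂ)` (value `⊤` off `L²`).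
The transform `𝓕` of `L²` extends `η ↦ ∫ e^{-2πixη} f(x) dx`; substituting `ξ = 2πη` gives
the factor `2π`. -/
def hDotHalfSq (f : ℝ → ℂ) : ℝ≥0∞ :=
  if hf : MemLp f 2 (volume : Measure ℝ) then
    ENNReal.ofReal (2 * Real.pi) *
      ∫⁻ η : ℝ, ‖(𝓕 (hf.toLp f) : Lp ℂ 2 (volume : Measure ℝ)) η‖ₑ ^ 2 * ENNReal.ofReal |η|
  else ⊤

/-- The `Ḣ^{1/2}(ℝ)` norm of a function with values in `ℂ³`. -/
def hDotHalfNorm (f : ℝ → Fin 3 → ℂ) : ℝ≥0∞ :=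
  (∑ i, hDotHalfSq (fun x => f x i)) ^ (1 / 2 : ℝ)

/-- `ρ i j t` is, for all `i`, `j` and `t`, some square root of `-2 sᵢ(t) · sⱼ(t)`
(dot product without conjugation). -/
def IsSpinRoot {N : ℕ} (s : Fin N → ℝ → Fin 3 → ℂ) (ρ : Fin N → Fin N → ℝ → ℂ) : Prop :=
  ∀ i j t, ρ i j t ^ 2 = -2 * (s i t ⬝ᵥ s j t)

/-- The diagonal matrix of the poles. -/
def matsunoX {N : ℕ} (p : Fin N → ℝ → ℂ) (t : ℝ) : Matrix (Fin N) (Fin N) ℂ :=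
  Matrix.diagonal (fun j => p j t)

/-- Matsuno's matrix `L`, for signs `ε` and roots `ρ i j = √(-2 sᵢ · sⱼ)`. -/
def matsunoL {N : ℕ} (ε : Fin N → Fin N → ℤˣ) (ρ : Fin N → Fin N → ℝ → ℂ)
    (p : Fin N → ℝ → ℂ) (t : ℝ) : Matrix (Fin N) (Fin N) ℂ :=
  Matrix.of fun i j =>
    if i = j then deriv (p i) t else ((ε i j : ℤ) : ℂ) * (ρ i j t / (p i t - p j t))

/-- Matsuno's matrix `B`. -/
def matsunoB {N : ℕ} (ε : Fin N → Fin N → ℤˣ) (ρ : Fin N → Fin N → ℝ → ℂ)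
    (p : Fin N → ℝ → ℂ) (t : ℝ) : Matrix (Fin N) (Fin N) ℂ :=
  Matrix.of fun i j =>
    if i = j then 0 else ((ε i j : ℤ) : ℂ) * (ρ i j t / (p i t - p j t) ^ 2)

/-- Matsuno's matrix `S`. -/
def matsunoS {N : ℕ} (ρ : Fin N → Fin N → ℝ → ℂ) (t : ℝ) : Matrix (Fin N) (Fin N) ℂ :=
  Matrix.of fun i j => if i = j then 0 else ρ i j t

end

/-! Write vectors of ℂ³ as traceless 2×2 matrices by means of the Pauli matrices. Comparing polar
parts in the sphere constraint and in the evolution equation shows that the spins are null, so that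
S_j = u_j w_j has rank one, and that spins and poles obey a closed first-order system, `IsSpinFlow`.
Let U have the columns u_j and W the rows w_j, let X be the diagonal matrix of the poles, and let L
have off-diagonal entries w_k u_j / (x_j - x_k) and diagonal entries the velocities of the poles.
Then L' = [L, B] and X' = L + [X, B] (`lax_equation`). Hence tr L and tr L² are conserved, (tr XL)'
= tr L², and ∑ (x_j - vt)² is a polynomial in t of degree at most two with t²-coefficient tr (L -
v)².

Rigidity comes from a hidden self-adjointness: L is symmetric for the positive definite form iΓ,
where Γ is the Cauchy–Gram matrix of the u_j (`cauchyGram_mul_eq`, `cauchyGram_posDef`). For real v,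
L - v is therefore similar to a Hermitian matrix, and tr (L - v)² = 0 forces L = v: all poles move
with velocity v, and w_k u_j = 0 for k ≠ j, so s_k · s_j = 0 and the spins are constant. It suffices
that x_j - vt stays bounded along some sequence of times tending to infinity.

Scattering provides this. The Ḣ^{1/2} norm controls, at each point of the lower half plane, the
derivative of the part of the function that is holomorphic there (`enorm_sum_div_sq_le`). Thus ∑ s_j
/ (ζ - (x_j - vt))² tends to ∑ c_k / (ζ - y_k)² for Im ζ < 0. Along a subsequence the shifted poles
converge in the projective line, and every y_k has to be one of the limits. There are N distinct y_k
and only N poles, so no pole escapes to infinity and no spin vanishes (`poles_bounded_of_tendsto`).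
-/

/-! ### Linear algebra: Sylvester uniqueness and symmetrizable matrices. -/

/-- Entrywise the equation reads (x j - conj (x k)) * D k j = 0. This uniqueness yields both the
symmetry of L for Γ and the formula for the derivative of Γ. -/
theorem sylvester_diagonal_eq_zero {N : ℕ} {x : Fin N → ℂ} (hx : ∀ j k, x j ≠ conj (x k))
    {D : Matrix (Fin N) (Fin N) ℂ} (h : D * diagonal x = (diagonal x)ᴴ * D) : D = 0 := by
  ext k j
  have h1 := congrFun (congrFun h k) j
  rw [mul_diagonal, diagonal_conjTranspose, diagonal_mul] at h1
  have h2 : D k j * (x j - conj (x k)) = 0 := by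
    rw [mul_sub, h1]
    simp [mul_comm]
  simpa [sub_ne_zero.2 (hx j k)] using h2

-- With H = RᴴR, the matrix RKR⁻¹ is Hermitian, so the trace of its square, which is tr K², is its
-- squared Hilbert–Schmidt norm.
open scoped ComplexOrder in
theorem eq_zero_of_posDef_of_trace_sq {N : ℕ} {H K : Matrix (Fin N) (Fin N) ℂ} (hH : H.PosDef)
    (h : H * K = Kᴴ * H) (htr : (K * K).trace = 0) : K = 0 := by
  obtain ⟨R, rfl⟩ : ∃ R : Matrix (Fin N) (Fin N) ℂ, H = Rᴴ * R := by
    open scoped MatrixOrder in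
    exact CStarAlgebra.nonneg_iff_eq_star_mul_self.1 hH.posSemidef.nonneg
  have hu : IsUnit R.det := by
    have := (isUnit_iff_isUnit_det _).1 hH.isUnit
    rw [det_mul] at this
    exact isUnit_of_mul_isUnit_right this
  have hu' : IsUnit Rᴴ.det := by rw [det_conjTranspose]; exact hu.star
  have hsym : (R * K * R⁻¹)ᴴ = R * K * R⁻¹ := by
    have e1 : R * K = (Rᴴ)⁻¹ * Kᴴ * Rᴴ * R := by
      rw [mul_assoc _ Kᴴ, mul_assoc _ (Kᴴ * Rᴴ), mul_assoc Kᴴ, ← h, mul_assoc Rᴴ,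
        nonsing_inv_mul_cancel_left _ _ hu']
    have e2 : R * K * R⁻¹ = (Rᴴ)⁻¹ * Kᴴ * Rᴴ := by
      rw [e1, mul_nonsing_inv_cancel_right _ _ hu]
    rw [conjTranspose_mul, conjTranspose_mul, conjTranspose_nonsing_inv, e2, mul_assoc]
  have h0 : R * K * R⁻¹ = 0 := by
    rw [← trace_conjTranspose_mul_self_eq_zero_iff, hsym]
    rw [show R * K * R⁻¹ * (R * K * R⁻¹) = R * (K * K) * R⁻¹ by
      rw [mul_assoc, mul_assoc, mul_assoc, nonsing_inv_mul_cancel_left _ _ hu]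
      simp only [mul_assoc],
      trace_mul_comm, nonsing_inv_mul_cancel_left _ _ hu, htr]
  have h1 : R⁻¹ * (R * K * R⁻¹) * R = K := by
    rw [mul_assoc, nonsing_inv_mul_cancel_right _ _ hu, nonsing_inv_mul_cancel_left _ _ hu]
  rw [← h1, h0]; simp

/-! ### The Cauchy–Gram matrix of the poles. -/

noncomputable section

/-- The Gram matrix (up to the factor `-i`) of the functions `s ↦ exp (i xⱼ s) uⱼ` on the half line. -/
def cauchyGram {N : ℕ} (x : Fin N → ℂ) (U : Matrix (Fin 2) (Fin N) ℂ) :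
    Matrix (Fin N) (Fin N) ℂ :=
  of fun k j => (∑ i, conj (U i k) * U i j) / (x j - conj (x k))

theorem cauchyGram_sylvester {N : ℕ} {x : Fin N → ℂ} (hx : ∀ j k, x j ≠ conj (x k))
    (U : Matrix (Fin 2) (Fin N) ℂ) :
    cauchyGram x U * diagonal x - (diagonal x)ᴴ * cauchyGram x U = Uᴴ * U := by
  ext k j
  rw [Matrix.sub_apply, mul_diagonal, diagonal_conjTranspose, diagonal_mul, mul_apply]
  have := sub_ne_zero.2 (hx j k)
  simp only [cauchyGram, of_apply, conjTranspose_apply, Pi.star_apply, RCLike.star_def]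
  field_simp

theorem cauchyGram_conjTranspose {N : ℕ} (x : Fin N → ℂ)
    (U : Matrix (Fin 2) (Fin N) ℂ) : (cauchyGram x U)ᴴ = - cauchyGram x U := by
  ext k j
  simp only [cauchyGram, of_apply, conjTranspose_apply, RCLike.star_def, map_div₀, map_sum, map_mul,
    Complex.conj_conj, map_sub, Matrix.neg_apply]
  rw [← neg_sub, div_neg]
  simp only [mul_comm]

-- Since i / (x_j - conj x_k) is the integral of exp(i (x_j - conj x_k) s) over s > 0, the quadratic
-- form of iΓ at z is the integral of |∑ z_j exp(i x_j s) u_j|².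
open scoped ComplexOrder in
theorem cauchyGram_posSemidef {N : ℕ} {x : Fin N → ℂ} (hx : ∀ j, 0 < (x j).im)
    (U : Matrix (Fin 2) (Fin N) ℂ) : (Complex.I • cauchyGram x U).PosSemidef := by
  refine .of_dotProduct_mulVec_nonneg ?_ fun z => ?_
  · rw [IsHermitian, conjTranspose_smul, cauchyGram_conjTranspose]; simp
  have hint : ∀ k j : Fin N, IntegrableOn
      (fun s : ℝ => Complex.exp (Complex.I * (x j - conj (x k)) * s)) (Set.Ioi 0) := fun k j =>
    integrableOn_exp_mul_complex_Ioi (by simp; linarith [hx j, hx k]) 0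
  have hval : ∀ k j : Fin N, Complex.I / (x j - conj (x k)) =
      ∫ s : ℝ in Set.Ioi 0, Complex.exp (Complex.I * (x j - conj (x k)) * s) := fun k j => by
    rw [integral_exp_mul_complex_Ioi (by simp; linarith [hx j, hx k]) 0]
    have : x j - conj (x k) ≠ 0 := fun h => by
      have := congrArg Complex.im h
      simp at this; linarith [hx j, hx k]
    field_simp; simp
  have key : star z ⬝ᵥ (Complex.I • cauchyGram x U) *ᵥ z =
      ∫ s : ℝ in Set.Ioi 0, (((∑ i, ‖∑ j, U i j * z j * Complex.exp (Complex.I * x j * s)‖ ^ 2 : ℝ)) : ℂ) := by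
    have e1 : ∀ s : ℝ, (((∑ i, ‖∑ j, U i j * z j * Complex.exp (Complex.I * x j * s)‖ ^ 2 : ℝ)) : ℂ) =
      ∑ k, ∑ j, conj (z k) * z j * (∑ i, conj (U i k) * U i j) *
        Complex.exp (Complex.I * (x j - conj (x k)) * s) := by
      intro s
      push_cast
      simp_rw [← Complex.conj_mul', map_sum, Finset.sum_mul_sum, Finset.mul_sum, Finset.sum_mul]
      rw [Finset.sum_comm]
      refine Finset.sum_congr rfl fun k _ => ?_
      rw [Finset.sum_comm]
      refine Finset.sum_congr rfl fun j _ => Finset.sum_congr rfl fun i _ => ?_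
      rw [map_mul, map_mul, ← Complex.exp_conj, mul_sub, sub_mul, sub_eq_add_neg, Complex.exp_add]
      simp only [map_mul, Complex.conj_I, Complex.conj_ofReal]
      rw [show -Complex.I * conj (x k) * s = -(Complex.I * conj (x k) * s) by ring]
      ring
    simp_rw [e1]
    rw [integral_finsetSum _ fun k _ => integrable_finsetSum _ fun j _ => (hint k j).const_mul _]
    simp only [dotProduct, mulVec, Pi.star_apply, RCLike.star_def]
    refine Finset.sum_congr rfl fun k _ => ?_
    rw [integral_finsetSum _ fun j _ => (hint k j).const_mul _, Finset.mul_sum]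
    refine Finset.sum_congr rfl fun j _ => ?_
    rw [integral_const_mul, ← hval]
    simp only [Matrix.smul_apply, cauchyGram, of_apply, smul_eq_mul]
    ring
  rw [key, integral_complex_ofReal, Complex.zero_le_real]
  exact integral_nonneg fun s => by positivity

-- By the Sylvester identity the kernel of Γ is contained in the kernel of U and is invariant under
-- X. A kernel vector z thus satisfies U Xⁿ z = 0 for all n, and a Vandermonde argument with
-- distinct poles gives z_j u_j = 0 for every j.
open scoped ComplexOrder in
theorem cauchyGram_posDef {N : ℕ} {x : Fin N → ℂ} (hx : ∀ j, 0 < (x j).im)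
    (hinj : Function.Injective x) {U : Matrix (Fin 2) (Fin N) ℂ} (hU : ∀ j, ∃ i, U i j ≠ 0) :
    (Complex.I • cauchyGram x U).PosDef := by
  have hne : ∀ j k, x j ≠ conj (x k) := fun j k h => by
    have := congrArg Complex.im h
    simp at this; linarith [hx j, hx k]
  rw [PosSemidef.posDef_iff_isUnit (cauchyGram_posSemidef hx U)]
  rw [isUnit_iff_isUnit_det, isUnit_iff_ne_zero]
  intro hdet
  obtain ⟨z, hz0, hz⟩ := exists_mulVec_eq_zero_iff.2 hdet
  rw [smul_mulVec, smul_eq_zero_iff_right Complex.I_ne_zero] at hz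
  have step : ∀ z, cauchyGram x U *ᵥ z = 0 →
      U *ᵥ z = 0 ∧ cauchyGram x U *ᵥ (diagonal x *ᵥ z) = 0 := by
    intro z hz
    have hs := congrArg (fun M => M *ᵥ z) (cauchyGram_sylvester hne U)
    simp only [sub_mulVec, ← mulVec_mulVec, hz, mulVec_zero, sub_zero] at hs
    -- Γ is anti-Hermitian, so Γz = 0 also gives z*Γ = 0, and pairing the identity with z leaves
    -- |Uz|² = 0.
    have h0 : star (U *ᵥ z) ⬝ᵥ (U *ᵥ z) = 0 := by
      rw [star_mulVec, ← dotProduct_mulVec, ← hs, dotProduct_mulVec,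
        ← star_star (star z ᵥ* cauchyGram x U), star_vecMul, star_star, cauchyGram_conjTranspose, neg_mulVec, hz]
      simp
    have h1 : U *ᵥ z = 0 := dotProduct_star_self_eq_zero.1 h0
    refine ⟨h1, ?_⟩
    rw [hs, h1, mulVec_zero]
  have hpow : ∀ n : ℕ, cauchyGram x U *ᵥ (fun j => x j ^ n * z j) = 0 := by
    intro n
    induction n with
    | zero => simpa using hz
    | succ n ih =>
      have := (step _ ih).2
      convert this using 2
      ext j
      rw [mulVec_diagonal]; ring
  apply hz0
  ext j
  obtain ⟨i, hi⟩ := hU j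
  have hv : (fun j => U i j * z j) = 0 := by
    apply eq_zero_of_forall_pow_sum_mul_pow_eq_zero hinj
    intro n
    have := congrFun (step _ (hpow n)).1 i
    simp only [mulVec, dotProduct, Pi.zero_apply] at this
    rw [← this]
    exact Finset.sum_congr rfl fun j _ => by ring
  have := congrFun hv j
  simpa [hi] using this

end

/-! ### Calculus of matrix valued curves. -/

/-- Entrywise derivative of a matrix valued curve. -/
def HasMatDerivAt {m n : Type*} (A : ℝ → Matrix m n ℂ) (A' : Matrix m n ℂ) (t : ℝ) : Prop :=
  ∀ i j, HasDerivAt (fun τ => A τ i j) (A' i j) t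

namespace HasMatDerivAt


theorem unique {m n : Type*} {t : ℝ} {A : ℝ → Matrix m n ℂ} {A' A'' : Matrix m n ℂ} (h : HasMatDerivAt A A' t)
    (h' : HasMatDerivAt A A'' t) : A' = A'' := by
  ext i j
  exact (h i j).unique (h' i j)

theorem mul {l m n : Type*} [Fintype m] {t : ℝ} {A : ℝ → Matrix l m ℂ} {B : ℝ → Matrix m n ℂ} {A' : Matrix l m ℂ} {B' : Matrix m n ℂ}
    (hA : HasMatDerivAt A A' t) (hB : HasMatDerivAt B B' t) :
    HasMatDerivAt (fun τ => A τ * B τ) (A' * B t + A t * B') t := by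
  intro i j
  simp only [mul_apply, Matrix.add_apply, ← Finset.sum_add_distrib]
  exact HasDerivAt.fun_sum fun k _ => (hA i k).mul (hB k j)

theorem add {m n : Type*} {t : ℝ} {A B : ℝ → Matrix m n ℂ} {A' B' : Matrix m n ℂ}
    (hA : HasMatDerivAt A A' t) (hB : HasMatDerivAt B B' t) :
    HasMatDerivAt (fun τ => A τ + B τ) (A' + B') t :=
  fun i j => (hA i j).add (hB i j)

theorem sub {m n : Type*} {t : ℝ} {A B : ℝ → Matrix m n ℂ} {A' B' : Matrix m n ℂ}
    (hA : HasMatDerivAt A A' t) (hB : HasMatDerivAt B B' t) :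
    HasMatDerivAt (fun τ => A τ - B τ) (A' - B') t :=
  fun i j => (hA i j).sub (hB i j)

theorem neg {m n : Type*} {t : ℝ} {A : ℝ → Matrix m n ℂ} {A' : Matrix m n ℂ}
    (hA : HasMatDerivAt A A' t) : HasMatDerivAt (fun τ => - A τ) (- A') t :=
  fun i j => (hA i j).neg

theorem const {m n : Type*} (t : ℝ) (A : Matrix m n ℂ) : HasMatDerivAt (fun _ => A) 0 t :=
  fun i j => hasDerivAt_const t (A i j)

theorem conjTranspose {m n : Type*} {t : ℝ} {A : ℝ → Matrix m n ℂ} {A' : Matrix m n ℂ}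
    (hA : HasMatDerivAt A A' t) : HasMatDerivAt (fun τ => (A τ)ᴴ) A'ᴴ t :=
  fun i j => (hA j i).star

theorem congr {m n : Type*} {t : ℝ} {A B : ℝ → Matrix m n ℂ} {A' : Matrix m n ℂ}
    (hA : HasMatDerivAt A A' t) (h : ∀ᶠ τ in 𝓝 t, B τ = A τ) : HasMatDerivAt B A' t :=
  fun i j => (hA i j).congr_of_eventuallyEq (h.mono fun τ hτ => by simp only [hτ])

theorem trace {m : Type*} [Fintype m] {t : ℝ} {A : ℝ → Matrix m m ℂ} {A' : Matrix m m ℂ}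
    (hA : HasMatDerivAt A A' t) : HasDerivAt (fun τ => (A τ).trace) A'.trace t := by
  simp only [Matrix.trace, diag_apply]
  exact HasDerivAt.fun_sum fun k _ => hA k k

end HasMatDerivAt

/-! ### The Lax equation and its trace identities. -/

/-- The defect D = ΓL - LᴴΓ satisfies DX = XᴴD: multiply `h3` by Uᴴ and subtract the adjoint, where
the M₀ terms cancel because M₀ is Hermitian; the remaining terms come from `h1` and the Sylvester
identity. -/
theorem cauchyGram_mul_eq {N : ℕ} {x : Fin N → ℂ} (hx : ∀ j k, x j ≠ conj (x k))
    {U : Matrix (Fin 2) (Fin N) ℂ} {W : Matrix (Fin N) (Fin 2) ℂ} {L : Matrix (Fin N) (Fin N) ℂ}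
    {M₀ : Matrix (Fin 2) (Fin 2) ℂ} (hM : M₀ᴴ = M₀)
    (h1 : diagonal x * L - L * diagonal x = -(W * U))
    (h3 : M₀ * U + U * L + Wᴴ * cauchyGram x U = 0) :
    cauchyGram x U * L = Lᴴ * cauchyGram x U := by
  have h2 := cauchyGram_sylvester hx U
  have hG := cauchyGram_conjTranspose x U
  set Γ := cauchyGram x U
  set X := diagonal x
  rw [← sub_eq_zero]
  refine sylvester_diagonal_eq_zero hx ?_
  change (Γ * L - Lᴴ * Γ) * X = Xᴴ * (Γ * L - Lᴴ * Γ)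
  have h1' := congrArg Matrix.conjTranspose h1
  have h3' := congrArg Matrix.conjTranspose h3
  simp only [conjTranspose_sub, conjTranspose_mul, conjTranspose_neg, conjTranspose_add,
    conjTranspose_conjTranspose, conjTranspose_zero, hM, hG] at h1' h3'
  have a1 := congrArg (fun M => Γ * M) h1
  have a2 := congrArg (fun M => M * Γ) h1'
  have a3 := congrArg (fun M => M * L) h2
  have a4 := congrArg (fun M => Lᴴ * M) h2
  have a5 := congrArg (fun M => Uᴴ * M) h3
  have a6 := congrArg (fun M => M * U) h3'
  simp only [Matrix.mul_sub, Matrix.sub_mul, Matrix.mul_add, Matrix.add_mul, Matrix.mul_neg,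
    Matrix.neg_mul, Matrix.mul_assoc, Matrix.mul_zero, Matrix.zero_mul] at a1 a2 a3 a4 a5 a6 ⊢
  linear_combination (norm := abel) - a1 - a2 + a3 - a4 + a5 - a6

/-- No second-order equation for the poles is needed: differentiating the algebraic identities `h1`
and `h3` determines L'. With Δ = L' - [L, B], the first makes Δ commute with X, hence diagonal, and
the second gives UΔ = 0, where U has no zero column. -/
theorem lax_equation {N : ℕ} {t₀ : ℝ} {x : ℝ → Fin N → ℂ} {U : ℝ → Matrix (Fin 2) (Fin N) ℂ}
    {W : ℝ → Matrix (Fin N) (Fin 2) ℂ} {L : ℝ → Matrix (Fin N) (Fin N) ℂ}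
    {M₀ : Matrix (Fin 2) (Fin 2) ℂ} {B L' : Matrix (Fin N) (Fin N) ℂ} (hM : M₀ᴴ = M₀)
    (hx : ∀ t j k, x t j ≠ conj (x t k)) (hinj : Function.Injective (x t₀))
    (hU : ∀ j, ∃ i, U t₀ i j ≠ 0)
    (h1 : ∀ᶠ t in 𝓝 t₀, diagonal (x t) * L t - L t * diagonal (x t) = -(W t * U t))
    (h3 : ∀ᶠ t in 𝓝 t₀, M₀ * U t + U t * L t + (W t)ᴴ * cauchyGram (x t) (U t) = 0)
    (hX : HasMatDerivAt (fun t => diagonal (x t))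
      (L t₀ + diagonal (x t₀) * B - B * diagonal (x t₀)) t₀)
    (hU' : HasMatDerivAt U (U t₀ * B) t₀) (hW' : HasMatDerivAt W (-(B * W t₀)) t₀)
    (hL' : HasMatDerivAt L L' t₀) :
    L' = L t₀ * B - B * L t₀ := by
  have hxd : ∀ j, HasDerivAt (fun t => x t j)
      ((L t₀ + diagonal (x t₀) * B - B * diagonal (x t₀)) j j) t₀ := fun j => by
    simpa using! hX j j
  obtain ⟨Γ', hΓ'⟩ : ∃ Γ', HasMatDerivAt (fun t => cauchyGram (x t) (U t)) Γ' t₀ := by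
    refine ⟨_, fun k j => DifferentiableAt.hasDerivAt ?_⟩
    refine DifferentiableAt.fun_div (DifferentiableAt.fun_sum fun i _ => ?_) ?_
      (sub_ne_zero.2 (hx t₀ j k))
    · exact (hU' i k).differentiableAt.star.mul (hU' i j).differentiableAt
    · exact (hxd j).differentiableAt.sub (hxd k).differentiableAt.star
  have h1₀ := h1.self_of_nhds
  have h3₀ := h3.self_of_nhds
  have h2 := fun t => cauchyGram_sylvester (hx t) (U t)
  have hsa := cauchyGram_mul_eq (hx t₀) hM h1₀ h3₀
  have d2 := (((hΓ'.mul hX).sub (hX.conjTranspose.mul hΓ')).congr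
    (Eventually.of_forall fun t => (h2 t).symm)).unique (hU'.conjTranspose.mul hU')
  have d3 := ((((HasMatDerivAt.const t₀ M₀).mul hU').add (hU'.mul hL')).add
    (hW'.conjTranspose.mul hΓ')).unique ((HasMatDerivAt.const t₀ 0).congr h3)
  have d1 := ((hX.mul hL').sub (hL'.mul hX)).unique ((hW'.mul hU').neg.congr h1)
  have h2₀ := h2 t₀
  beta_reduce at d1 d2 d3
  set Γ := cauchyGram (x t₀) (U t₀)
  set X := diagonal (x t₀)
  set L₀ := L t₀
  set U₀ := U t₀
  set W₀ := W t₀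
  -- Differentiate the Sylvester identity; the terms from L in X' cancel because ΓL = LᴴΓ.
  have hΓ : Γ' = Γ * B + Bᴴ * Γ := by
    rw [← sub_eq_zero]
    refine sylvester_diagonal_eq_zero (hx t₀) ?_
    have a1 := congrArg (fun M => Bᴴ * M) h2₀
    have a2 := congrArg (fun M => M * B) h2₀
    simp only [conjTranspose_sub, conjTranspose_mul, conjTranspose_add,
      Matrix.mul_sub, Matrix.sub_mul, Matrix.mul_add, Matrix.add_mul,
      Matrix.mul_assoc] at a1 a2 d2 ⊢
    linear_combination (norm := abel) d2 - a1 - a2 - hsa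
  have hUΔ : U₀ * (L' - (L₀ * B - B * L₀)) = 0 := by
    have a1 := congrArg (fun M => M * B) h3₀
    simp only [hΓ, conjTranspose_mul, conjTranspose_neg,
      Matrix.mul_sub, Matrix.mul_add, Matrix.add_mul,
      Matrix.neg_mul, Matrix.mul_assoc, Matrix.zero_mul] at a1 d3 ⊢
    linear_combination (norm := abel) d3 - a1
  have hXΔ : X * (L' - (L₀ * B - B * L₀)) = (L' - (L₀ * B - B * L₀)) * X := by
    have a1 := congrArg (fun M => B * M) h1₀
    have a2 := congrArg (fun M => M * B) h1₀
    simp only [Matrix.mul_sub, Matrix.sub_mul, Matrix.mul_add, Matrix.add_mul, Matrix.mul_neg,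
      Matrix.neg_mul, Matrix.mul_assoc] at a1 a2 d1 ⊢
    linear_combination (norm := abel) d1 + a1 - a2
  rw [← sub_eq_zero]
  set Δ := L' - (L₀ * B - B * L₀)
  have hoff : ∀ i j, i ≠ j → Δ i j = 0 := fun i j hij => by
    have := congrFun (congrFun hXΔ i) j
    rw [diagonal_mul, mul_diagonal] at this
    have h0 : (x t₀ i - x t₀ j) * Δ i j = 0 := by rw [sub_mul, this]; ring
    simpa [sub_ne_zero.2 (hinj.ne hij)] using h0
  ext i j
  rcases eq_or_ne i j with rfl | hij
  · obtain ⟨k, hk⟩ := hU i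
    have := congrFun (congrFun hUΔ k) i
    rw [mul_apply, Finset.sum_eq_single i (fun b _ hb => by rw [hoff b i hb, mul_zero])
      (by simp)] at this
    simpa [hk] using this
  · exact hoff i j hij

theorem trace_mul_self_deriv {N : ℕ} {t₀ : ℝ} {L : ℝ → Matrix (Fin N) (Fin N) ℂ}
    {B : Matrix (Fin N) (Fin N) ℂ} (hL : HasMatDerivAt L (L t₀ * B - B * L t₀) t₀) :
    HasDerivAt (fun t => (L t * L t).trace) 0 t₀ := by
  convert (hL.mul hL).trace using 1
  simp only [Matrix.mul_sub, Matrix.sub_mul, trace_add, trace_sub, Matrix.mul_assoc]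
  rw [trace_mul_comm B]
  simp [Matrix.mul_assoc]

/-- The commutators with B cancel under the trace. Since tr (L²) is constant, tr (XL) is then affine
in time. -/
theorem trace_mul_deriv {N : ℕ} {t₀ : ℝ} {X L : ℝ → Matrix (Fin N) (Fin N) ℂ}
    {B : Matrix (Fin N) (Fin N) ℂ} (hX : HasMatDerivAt X (L t₀ + X t₀ * B - B * X t₀) t₀)
    (hL : HasMatDerivAt L (L t₀ * B - B * L t₀) t₀) :
    HasDerivAt (fun t => (X t * L t).trace) (L t₀ * L t₀).trace t₀ := by
  convert (hX.mul hL).trace using 1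
  simp only [Matrix.mul_sub, Matrix.sub_mul, Matrix.add_mul, trace_add, trace_sub, Matrix.mul_assoc]
  rw [trace_mul_comm B]
  simp [Matrix.mul_assoc]

/-! ### Rank-one spins, the spin flow and its Lax pair. -/

/-- Splitting S = u w turns S' = [C, S] into u' = Cu + αu and w' = -(wC + αw); the scalar α reflects
the freedom to rescale u and w inversely. -/
theorem exists_rank_one_factorization {S : ℝ → Matrix (Fin 2) (Fin 2) ℂ}
    {C : Matrix (Fin 2) (Fin 2) ℂ} {t₀ : ℝ} (hS' : HasMatDerivAt S (C * S t₀ - S t₀ * C) t₀)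
    (hrk : ∀ t i j k l, S t i j * S t k l = S t i l * S t k j) (h0 : S t₀ ≠ 0) :
    ∃ (u w : ℝ → Fin 2 → ℂ) (α : ℂ), (∀ᶠ t in 𝓝 t₀, ∀ a b, S t a b = u t a * w t b) ∧
      (∀ a, HasDerivAt (fun t => u t a) ((C *ᵥ u t₀) a + α * u t₀ a) t₀) ∧
      ∀ b, HasDerivAt (fun t => w t b) (-((w t₀ ᵥ* C) b + α * w t₀ b)) t₀ := by
  obtain ⟨a₀, b₀, hab⟩ : ∃ a b, S t₀ a b ≠ 0 := by
    by_contra! h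
    exact h0 (by ext a b; simpa using h a b)
  have hfac : ∀ᶠ t in 𝓝 t₀, ∀ a b, S t a b = S t a b₀ * (S t a₀ b / S t a₀ b₀) := by
    filter_upwards [(hS' a₀ b₀).continuousAt.eventually_ne hab] with t ht a b
    rw [← mul_div_assoc, eq_div_iff ht, hrk]
  have hfac₀ := hfac.self_of_nhds
  have hw : ∀ b, ∃ w', HasDerivAt (fun t => S t a₀ b / S t a₀ b₀) w' t₀ := fun b =>
    ⟨_, (hS' a₀ b).div (hS' a₀ b₀) hab⟩
  choose w' hw' using hw
  have hu : ∀ a, (C * S t₀ - S t₀ * C) a b₀ = (C *ᵥ fun a => S t₀ a b₀) a +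
      -((fun b => S t₀ a₀ b / S t₀ a₀ b₀) ⬝ᵥ fun a => C a b₀) * S t₀ a b₀ := fun a => by
    simp only [Matrix.sub_apply, mul_apply, mulVec, dotProduct, Fin.sum_univ_two]
    rw [hfac₀ a 0, hfac₀ a 1]
    ring
  -- u is the column through a nonzero entry and w the row through it, normalized so that w b₀ = 1;
  -- keeping this normalization in time fixes α.
  refine ⟨fun t a => S t a b₀, fun t b => S t a₀ b / S t a₀ b₀,
    -((fun b => S t₀ a₀ b / S t₀ a₀ b₀) ⬝ᵥ fun a => C a b₀), hfac, fun a => ?_, fun b => ?_⟩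
  · rw [← hu]
    exact hS' a b₀
  · have h1 := ((hS' a₀ b₀).mul (hw' b)).unique ((hS' a₀ b).congr_of_eventuallyEq
      (hfac.mono fun t ht => (ht a₀ b).symm))
    convert hw' b using 1
    refine mul_left_cancel₀ hab ?_
    rw [hu] at h1
    set q : Fin 2 → ℂ := fun b => S t₀ a₀ b / S t₀ a₀ b₀
    have e0 : S t₀ a₀ 0 = S t₀ a₀ b₀ * q 0 := hfac₀ a₀ 0
    have e1 : S t₀ a₀ 1 = S t₀ a₀ b₀ * q 1 := hfac₀ a₀ 1
    have e2 : S t₀ 0 b = S t₀ 0 b₀ * q b := hfac₀ 0 b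
    have e3 : S t₀ 1 b = S t₀ 1 b₀ * q b := hfac₀ 1 b
    change _ * q b + _ = _ at h1
    change _ * -((q ᵥ* C) b + -(q ⬝ᵥ fun a => C a b₀) * q b) = _
    clear_value q
    simp only [Matrix.sub_apply, mul_apply, mulVec, vecMul, dotProduct, Fin.sum_univ_two] at h1 ⊢
    rw [e0, e1, e2, e3] at h1
    linear_combination -h1

theorem ite_zero_apply {m n : Type*} (p : Prop) [Decidable p] (A : Matrix m n ℂ) (i : m) (j : n) :
    (if p then 0 else A) i j = if p then 0 else A i j := by
  split_ifs <;> rfl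

/-- The equations of motion of the spins (as null matrices) and poles of a rational solution. -/
structure IsSpinFlow {N : ℕ} (M₀ : Matrix (Fin 2) (Fin 2) ℂ)
    (S : Fin N → ℝ → Matrix (Fin 2) (Fin 2) ℂ) (x : Fin N → ℝ → ℂ) : Prop where
  hermitian : M₀ᴴ = M₀
  differentiable : ∀ j, Differentiable ℝ (x j)
  im_pos : ∀ j t, 0 < (x j t).im
  injective : ∀ t, Function.Injective fun j => x j t
  trace_eq_zero : ∀ j t, (S j t).trace = 0
  rank_one : ∀ j t a b c d, S j t a b * S j t c d = S j t a d * S j t c b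
  ne_zero : ∀ j t, S j t ≠ 0
  spin : ∀ j t, HasMatDerivAt (S j)
    ((∑ k, if k = j then 0 else ((x j t - x k t) ^ 2)⁻¹ • S k t) * S j t -
      S j t * ∑ k, if k = j then 0 else ((x j t - x k t) ^ 2)⁻¹ • S k t) t
  pole : ∀ j t, (M₀ + (∑ k, if k = j then 0 else (x j t - x k t)⁻¹ • S k t) +
    ∑ k, (x j t - conj (x k t))⁻¹ • (S k t)ᴴ) * S j t = - deriv (x j) t • S j t

namespace IsSpinFlow

variable {N : ℕ} {M₀ : Matrix (Fin 2) (Fin 2) ℂ} {S : Fin N → ℝ → Matrix (Fin 2) (Fin 2) ℂ}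
  {x : Fin N → ℝ → ℂ}

theorem ne_conj (h : IsSpinFlow M₀ S x) (t : ℝ) (j k : Fin N) : x j t ≠ conj (x k t) := fun e => by
  have := congrArg Complex.im e
  simp at this
  linarith [h.im_pos j t, h.im_pos k t]

/-- Dividing the pole equation by a nonzero entry of S_j expresses the velocity through
differentiable quantities. This makes L differentiable. -/
theorem differentiable_deriv (h : IsSpinFlow M₀ S x) (j : Fin N) (t : ℝ) :
    DifferentiableAt ℝ (deriv (x j)) t := by
  obtain ⟨a, b, hab⟩ : ∃ a b, S j t a b ≠ 0 := by
    by_contra! h'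
    exact h.ne_zero j t (by ext a b; simpa using h' a b)
  have hS : ∀ k, ∀ a b, DifferentiableAt ℝ (fun τ => S k τ a b) t := fun k a b =>
    (h.spin k t a b).differentiableAt
  have he : deriv (x j) =ᶠ[𝓝 t] fun τ => -((∑ c, (M₀ a c +
      (∑ k, if k = j then 0 else (x j τ - x k τ)⁻¹ * S k τ a c) +
      ∑ k, (x j τ - conj (x k τ))⁻¹ * conj (S k τ c a)) * S j τ c b) / S j τ a b) := by
    filter_upwards [(hS j a b).continuousAt.eventually_ne hab] with τ hτ
    have := congrFun (congrFun (h.pole j τ) a) b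
    rw [mul_apply] at this
    rw [← neg_div, eq_div_iff hτ]
    simp only [Matrix.smul_apply, Matrix.add_apply, Matrix.sum_apply, smul_eq_mul,
      conjTranspose_apply, RCLike.star_def, ite_zero_apply] at this
    linear_combination this
  refine DifferentiableAt.congr_of_eventuallyEq ?_ he
  refine ((DifferentiableAt.fun_sum fun c _ => ?_).fun_div (hS j a b) hab).neg
  refine (((differentiableAt_const _).add (DifferentiableAt.fun_sum fun k _ => ?_)).add
    (DifferentiableAt.fun_sum fun k _ => ?_)).mul (hS j c b)
  · split_ifs with hk
    · exact differentiableAt_const _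
    · exact (((h.differentiable j t).sub (h.differentiable k t)).fun_inv
        (sub_ne_zero.2 ((h.injective t).ne (Ne.symm hk)))).mul (hS k a c)
  · exact (((h.differentiable j t).sub (h.differentiable k t).star).fun_inv
        (sub_ne_zero.2 (h.ne_conj t j k))).mul (hS k c a).star

/-- The factorization is constructed only near t₀. The off-diagonal part of B comes from S_k u_j =
u_k (w_k u_j), and its diagonal holds the scaling terms α_j. -/
theorem exists_lax_pair (h : IsSpinFlow M₀ S x) (t₀ : ℝ) :
    ∃ (U : ℝ → Matrix (Fin 2) (Fin N) ℂ) (W : ℝ → Matrix (Fin N) (Fin 2) ℂ)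
      (B : Matrix (Fin N) (Fin N) ℂ),
      (∀ᶠ t in 𝓝 t₀, ∀ j a b, S j t a b = U t a j * W t j b) ∧
      HasMatDerivAt U (U t₀ * B) t₀ ∧ HasMatDerivAt W (-(B * W t₀)) t₀ ∧
      ∀ k j, k ≠ j → B k j = (W t₀ * U t₀) k j / (x j t₀ - x k t₀) ^ 2 := by
  choose u w α hS hu hw using fun j =>
    exists_rank_one_factorization (h.spin j t₀) (fun t a b c d => h.rank_one j t a b c d)
      (h.ne_zero j t₀)
  obtain ⟨U, hUe⟩ : ∃ U : ℝ → Matrix (Fin 2) (Fin N) ℂ, ∀ t a j, u j t a = U t a j :=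
    ⟨fun t => of fun a j => u j t a, fun _ _ _ => rfl⟩
  obtain ⟨W, hWe⟩ : ∃ W : ℝ → Matrix (Fin N) (Fin 2) ℂ, ∀ t j b, w j t b = W t j b :=
    ⟨fun t => of fun j b => w j t b, fun _ _ _ => rfl⟩
  simp only [mulVec, vecMul, dotProduct, Matrix.sum_apply, ite_zero_apply, Matrix.smul_apply,
    smul_eq_mul, hUe, hWe] at hS hu hw
  have hS₀ := fun j => (hS j).self_of_nhds
  refine ⟨U, W, of fun k j => if k = j then α j else
      (W t₀ * U t₀) k j / (x j t₀ - x k t₀) ^ 2, eventually_all.2 hS, fun a j => ?_, fun j b => ?_,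
        fun k j hkj => by simp [hkj]⟩
  · convert hu j a using 1
    rw [show α j * U t₀ a j = ∑ k, if k = j then α j * U t₀ a j else 0 by simp, mul_apply]
    simp only [Finset.sum_mul]
    rw [Finset.sum_comm, ← Finset.sum_add_distrib]
    refine Finset.sum_congr rfl fun k _ => ?_
    rcases eq_or_ne k j with rfl | hkj
    · simp [mul_comm]
    · simp only [of_apply, hkj, if_false, hS₀, mul_apply, Fin.sum_univ_two]
      ring
  · convert hw j b using 1
    rw [show α j * W t₀ j b = ∑ k, if k = j then α j * W t₀ j b else 0 by simp, Matrix.neg_apply,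
      mul_apply]
    simp only [Finset.mul_sum]
    rw [Finset.sum_comm, ← Finset.sum_add_distrib]
    congr 1
    refine Finset.sum_congr rfl fun k _ => ?_
    rcases eq_or_ne k j with rfl | hkj
    · simp
    · simp only [of_apply, hkj, hkj.symm, if_false, hS₀, mul_apply, Fin.sum_univ_two]
      rw [← neg_sub (x j t₀) (x k t₀), neg_sq]
      ring

/-- The trace of the square of the Lax matrix. -/
noncomputable def laxEnergy (S : Fin N → ℝ → Matrix (Fin 2) (Fin 2) ℂ) (x : Fin N → ℝ → ℂ) (t : ℝ) : ℂ :=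
  ∑ j, ∑ k, if j = k then deriv (x j) t ^ 2 else
    - (S j t * S k t).trace / (x j t - x k t) ^ 2

/-- The Lax matrix in the gauge given by factors `U`, `W` of the spins. -/
noncomputable def laxMatrix (U : ℝ → Matrix (Fin 2) (Fin N) ℂ) (W : ℝ → Matrix (Fin N) (Fin 2) ℂ)
    (x : Fin N → ℝ → ℂ) (t : ℝ) : Matrix (Fin N) (Fin N) ℂ :=
  of fun k j => if k = j then deriv (x j) t else (W t * U t) k j / (x j t - x k t)

/-- Off the diagonal this is the definition of L; on the diagonal it says w_j u_j = tr S_j = 0. -/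
theorem laxMatrix_commutator (h : IsSpinFlow M₀ S x) {U : ℝ → Matrix (Fin 2) (Fin N) ℂ}
    {W : ℝ → Matrix (Fin N) (Fin 2) ℂ} {t : ℝ} (hS : ∀ j a b, S j t a b = U t a j * W t j b) :
    diagonal (fun j => x j t) * laxMatrix U W x t - laxMatrix U W x t * diagonal (fun j => x j t) =
      -(W t * U t) := by
  ext k j
  rw [Matrix.sub_apply, diagonal_mul, mul_diagonal, Matrix.neg_apply, laxMatrix, of_apply]
  rcases eq_or_ne k j with rfl | hkj
  · have := h.trace_eq_zero k t
    simp only [trace_fin_two, hS] at this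
    rw [if_pos rfl]
    simp only [mul_apply, Fin.sum_univ_two]
    linear_combination this
  · have := sub_ne_zero.2 ((h.injective t).ne hkj.symm)
    rw [if_neg hkj]
    field_simp
    ring

/-- Column j is the equation of the j-th pole with the right factor w_j cancelled: the other poles
and the velocity make up UL, the conjugate poles make up WᴴΓ. -/
theorem laxMatrix_intertwines (h : IsSpinFlow M₀ S x) {U : ℝ → Matrix (Fin 2) (Fin N) ℂ}
    {W : ℝ → Matrix (Fin N) (Fin 2) ℂ} {t : ℝ} (hS : ∀ j a b, S j t a b = U t a j * W t j b) :
    M₀ * U t + U t * laxMatrix U W x t + (W t)ᴴ * cauchyGram (fun j => x j t) (U t) = 0 := by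
  ext a j
  obtain ⟨c, b, hcb⟩ : ∃ a b, S j t a b ≠ 0 := by
    by_contra! h'
    exact h.ne_zero j t (by ext a b; simpa using h' a b)
  have hb : W t j b ≠ 0 := fun h0 => hcb (by rw [hS, h0, mul_zero])
  refine mul_right_cancel₀ hb ?_
  have := congrFun (congrFun (h.pole j t) a) b
  simp only [Matrix.smul_apply, Matrix.add_apply, Matrix.sum_apply, smul_eq_mul,
    mul_apply (N := S j t), conjTranspose_apply, RCLike.star_def, ite_zero_apply,
    Fin.sum_univ_two, hS, map_mul] at this
  rw [Matrix.add_apply, Matrix.add_apply, mul_apply (M := U t), mul_apply (N := cauchyGram _ _),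
    Matrix.zero_apply, zero_mul, mul_apply, Fin.sum_univ_two]
  have e1 : ∑ k, U t a k * laxMatrix U W x t k j = U t a j * deriv (x j) t +
      U t 0 j * (∑ k, if k = j then 0 else (x j t - x k t)⁻¹ * (U t a k * W t k 0)) +
      U t 1 j * (∑ k, if k = j then 0 else (x j t - x k t)⁻¹ * (U t a k * W t k 1)) := by
    rw [show U t a j * deriv (x j) t = ∑ k, if k = j then U t a j * deriv (x j) t else 0 by simp,
      Finset.mul_sum, Finset.mul_sum, ← Finset.sum_add_distrib, ← Finset.sum_add_distrib]
    refine Finset.sum_congr rfl fun k _ => ?_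
    rcases eq_or_ne k j with rfl | hkj
    · simp [laxMatrix]
    · simp only [laxMatrix, of_apply, hkj, if_false, mul_apply, Fin.sum_univ_two]
      ring
  have e2 : ∑ k, (W t)ᴴ a k * cauchyGram (fun j => x j t) (U t) k j =
      U t 0 j * (∑ k, (x j t - conj (x k t))⁻¹ * (conj (U t 0 k) * conj (W t k a))) +
      U t 1 j * (∑ k, (x j t - conj (x k t))⁻¹ * (conj (U t 1 k) * conj (W t k a))) := by
    rw [Finset.mul_sum, Finset.mul_sum, ← Finset.sum_add_distrib]
    refine Finset.sum_congr rfl fun k _ => ?_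
    simp only [cauchyGram, of_apply, Fin.sum_univ_two, conjTranspose_apply, RCLike.star_def]
    ring
  rw [e1, e2]
  linear_combination this

/-- The products (w_j u_k)(w_k u_j) = tr (S_j S_k) do not depend on the factorization, so tr L² is a
function of time defined globally, unlike L. -/
theorem laxEnergy_eq {U : ℝ → Matrix (Fin 2) (Fin N) ℂ}
    {W : ℝ → Matrix (Fin N) (Fin 2) ℂ} {t : ℝ} (hS : ∀ j a b, S j t a b = U t a j * W t j b) :
    laxEnergy S x t = (laxMatrix U W x t * laxMatrix U W x t).trace := by
  simp only [Matrix.trace, diag_apply, mul_apply (M := laxMatrix U W x t), laxEnergy]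
  refine Finset.sum_congr rfl fun j _ => Finset.sum_congr rfl fun k _ => ?_
  rcases eq_or_ne j k with rfl | hkj
  · simp [laxMatrix, sq]
  · rw [laxMatrix, of_apply, of_apply, if_neg hkj, if_neg hkj, if_neg hkj.symm, div_mul_div_comm,
      show (x k t - x j t) * (x j t - x k t) = -(x j t - x k t) ^ 2 by ring, div_neg, neg_div]
    congr 2
    simp only [mul_apply, hS, Fin.sum_univ_two]
    ring

theorem moments (h : IsSpinFlow M₀ S x) (t₀ : ℝ) :
    HasDerivAt (fun t => ∑ j, deriv (x j) t) 0 t₀ ∧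
    HasDerivAt (fun t => ∑ j, x j t * deriv (x j) t) (laxEnergy S x t₀) t₀ ∧
    HasDerivAt (laxEnergy S x) 0 t₀ := by
  obtain ⟨U, W, B, hS, hU, hW, hB⟩ := h.exists_lax_pair t₀
  have hS₀ := hS.self_of_nhds
  have hX : HasMatDerivAt (fun t => diagonal fun j => x j t) (laxMatrix U W x t₀ +
      diagonal (fun j => x j t₀) * B - B * diagonal (fun j => x j t₀)) t₀ := by
    intro k j
    rw [Matrix.sub_apply, Matrix.add_apply, diagonal_mul, mul_diagonal]
    rcases eq_or_ne k j with rfl | hkj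
    · simp only [diagonal_apply_eq, laxMatrix, of_apply, if_true]
      refine (h.differentiable k t₀).hasDerivAt.congr_deriv ?_
      ring
    · simp only [diagonal_apply_ne _ hkj, laxMatrix, of_apply, if_neg hkj, hB k j hkj]
      refine (hasDerivAt_const t₀ (0 : ℂ)).congr_deriv ?_
      have := sub_ne_zero.2 ((h.injective t₀).ne hkj.symm)
      field_simp
      ring
  obtain ⟨L', hL'⟩ : ∃ L', HasMatDerivAt (laxMatrix U W x) L' t₀ := by
    refine ⟨_, fun k j => DifferentiableAt.hasDerivAt ?_⟩
    simp only [laxMatrix, of_apply]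
    rcases eq_or_ne k j with rfl | hkj
    · simpa using! h.differentiable_deriv k t₀
    · simp only [if_neg hkj]
      exact (hW.mul hU k j).differentiableAt.fun_div
        ((h.differentiable j t₀).sub (h.differentiable k t₀))
        (sub_ne_zero.2 ((h.injective t₀).ne hkj.symm))
  have hlax := lax_equation h.hermitian (x := fun t j => x j t) h.ne_conj (h.injective t₀)
    (fun j => by
      by_contra! h0
      exact h.ne_zero j t₀ (by ext a b; simp [hS₀, h0]))
    (hS.mono fun t => h.laxMatrix_commutator) (hS.mono fun t => h.laxMatrix_intertwines)
    hX hU hW hL'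
  subst hlax
  refine ⟨?_, ?_, ?_⟩
  · convert hL'.trace using 1
    · ext t; simp [Matrix.trace, laxMatrix]
    · rw [trace_sub, trace_mul_comm, sub_self]
  · rw [laxEnergy_eq hS₀]
    convert trace_mul_deriv hX hL' using 1
    ext t
    simp [Matrix.trace, laxMatrix, diagonal_mul]
  · exact (trace_mul_self_deriv hL').congr_of_eventuallyEq (hS.mono fun t => laxEnergy_eq)

/-- The hypothesis says tr (L - v)² = 0, and v is real, so L - v is symmetric for the positive
definite form iΓ and must vanish. Its off-diagonal entries give w_j u_k = 0, hence S_j S_k = 0. -/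
theorem rigidity (h : IsSpinFlow M₀ S x) {v t : ℝ}
    (hE : laxEnergy S x t - 2 * v * ∑ j, deriv (x j) t + N * v ^ 2 = 0) :
    (∀ j, deriv (x j) t = v) ∧ ∀ j k, j ≠ k → S j t * S k t = 0 := by
  obtain ⟨U, W, B, hS, -, -, -⟩ := h.exists_lax_pair t
  replace hS := hS.self_of_nhds
  have hsa := cauchyGram_mul_eq (h.ne_conj t) h.hermitian (h.laxMatrix_commutator hS)
    (h.laxMatrix_intertwines hS)
  have hpd := cauchyGram_posDef (fun j => h.im_pos j t) (h.injective t) (U := U t) fun j => by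
    by_contra! h0
    exact h.ne_zero j t (by ext a b; simp [hS, h0])
  have hK : laxMatrix U W x t - (v : ℂ) • 1 = 0 := by
    refine eq_zero_of_posDef_of_trace_sq hpd ?_ ?_
    · simp only [Matrix.smul_mul, Matrix.mul_smul, Matrix.mul_sub, conjTranspose_sub,
        conjTranspose_smul, conjTranspose_one, Matrix.sub_mul, hsa, Matrix.mul_one, Matrix.one_mul,
        smul_sub, RCLike.star_def, Complex.conj_ofReal]
      rw [smul_comm Complex.I (v : ℂ)]
    · rw [← hE, laxEnergy_eq hS]
      simp only [Matrix.mul_sub, Matrix.sub_mul, trace_sub, Matrix.smul_mul, Matrix.mul_smul,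
        trace_smul, Matrix.mul_one, Matrix.one_mul, trace_one, smul_eq_mul, Fintype.card_fin]
      rw [show ∑ j, deriv (x j) t = (laxMatrix U W x t).trace by simp [Matrix.trace, laxMatrix]]
      ring
  have hK' : ∀ k j, laxMatrix U W x t k j = ((v : ℂ) • (1 : Matrix (Fin N) (Fin N) ℂ)) k j :=
    fun k j => by rw [sub_eq_zero.1 hK]
  refine ⟨fun j => by simpa [laxMatrix] using hK' j j, fun j k hjk => ?_⟩
  have h0 : (W t * U t) j k = 0 := by
    simpa [laxMatrix, hjk, sub_ne_zero.2 ((h.injective t).ne hjk.symm)] using hK' j k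
  ext a b
  simp only [mul_apply, Fin.sum_univ_two, hS, Matrix.zero_apply] at h0 ⊢
  linear_combination U t a j * W t k b * h0

end IsSpinFlow

/-! ### Bounded poles force a travelling wave. -/

theorem eq_zero_of_quadratic_bounded {a b c : ℂ} {R : ℝ} {τ : ℕ → ℝ}
    (hτ : Tendsto τ atTop atTop) (h : ∀ n, ‖a + b * τ n + c * (τ n : ℂ) ^ 2‖ ≤ R) : c = 0 := by
  have hinv : Tendsto (fun n => ((τ n : ℂ))⁻¹) atTop (𝓝 0) := by
    have := (Complex.continuous_ofReal.tendsto 0).comp (tendsto_inv_atTop_zero.comp hτ)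
    simpa [Function.comp_def] using this
  have h1 : Tendsto (fun n => a * ((τ n : ℂ))⁻¹ ^ 2 + b * ((τ n : ℂ))⁻¹ + c) atTop (𝓝 c) := by
    simpa using ((hinv.pow 2).const_mul a).add (hinv.const_mul b) |>.add_const c
  have h2 : Tendsto (fun n => (a + b * τ n + c * (τ n : ℂ) ^ 2) * ((τ n : ℂ))⁻¹ ^ 2) atTop
      (𝓝 0) := by
    have h3 := (hinv.pow 2).norm.const_mul R
    simp only [ne_eq, OfNat.ofNat_ne_zero, not_false_eq_true, zero_pow, norm_zero, mul_zero] at h3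
    refine squeeze_zero_norm (fun n => ?_) h3
    rw [norm_mul]
    exact mul_le_mul_of_nonneg_right (h n) (norm_nonneg _)
  refine tendsto_nhds_unique (h1.congr' ?_) h2
  filter_upwards [hτ.eventually_gt_atTop 0] with n hn
  have : (τ n : ℂ) ≠ 0 := by exact_mod_cast hn.ne'
  field_simp

theorem eq_of_hasDerivAt_zero {f : ℝ → ℂ} (h : ∀ t, HasDerivAt f 0 t) (s t : ℝ) : f s = f t :=
  is_const_of_deriv_eq_zero (fun t => (h t).differentiableAt) (fun t => (h t).deriv) s t

namespace IsSpinFlow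

variable {N : ℕ} {M₀ : Matrix (Fin 2) (Fin 2) ℂ} {S : Fin N → ℝ → Matrix (Fin 2) (Fin 2) ℂ}
  {x : Fin N → ℝ → ℂ}

/-- The function Z = ∑ (x_j - vt)² satisfies Z' = G and G' = 2κ with κ = tr (L - v)² constant. As Z
is bounded along τ, its t²-coefficient κ is zero. -/
theorem laxEnergy_eq_of_bounded (h : IsSpinFlow M₀ S x) {v R : ℝ} {τ : ℕ → ℝ}
    (hτ : Tendsto τ atTop atTop) (hb : ∀ n j, ‖x j (τ n) - v * τ n‖ ≤ R) (t : ℝ) :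
    laxEnergy S x t - 2 * v * ∑ j, deriv (x j) t + N * v ^ 2 = 0 := by
  set F : ℝ → ℂ := fun t => ∑ j, deriv (x j) t
  set κ : ℝ → ℂ := fun t => laxEnergy S x t - 2 * v * F t + N * v ^ 2 with hκ
  have hF : ∀ t, HasDerivAt F 0 t := fun t => (h.moments t).1
  have hκ' : ∀ t, HasDerivAt κ 0 t := fun t => by
    refine (((h.moments t).2.2.sub ((hF t).const_mul _)).add_const _).congr_deriv ?_
    simp
  have hid : ∀ t : ℝ, HasDerivAt (fun t : ℝ => (t : ℂ)) 1 t := fun t => Complex.ofRealCLM.hasDerivAt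
  set G : ℝ → ℂ := fun t => 2 * ((∑ j, x j t * deriv (x j) t) - v * (∑ j, x j t) - v * t * F t +
    N * v ^ 2 * t)
  have hG : ∀ t, HasDerivAt G (2 * κ t) t := fun t => by
    have h1 : HasDerivAt (fun t => ∑ j, x j t) (F t) t :=
      HasDerivAt.fun_sum fun j _ => (h.differentiable j t).hasDerivAt
    refine ((((h.moments t).2.1.sub (h1.const_mul (v : ℂ))).sub
      (((hid t).const_mul (v : ℂ)).mul (hF t))).add ((hid t).const_mul _)).const_mul 2
        |>.congr_deriv ?_
    simp only [hκ]
    ring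
  have hG1 : ∀ t, G t = G 0 + 2 * κ 0 * t := fun t => by
    have : ∀ t, HasDerivAt (fun t => G t - 2 * κ 0 * t) 0 t := fun t => by
      refine ((hG t).sub ((hid t).const_mul _)).congr_deriv ?_
      rw [eq_of_hasDerivAt_zero hκ' t 0]
      ring
    have := eq_of_hasDerivAt_zero this t 0
    simp only [Complex.ofReal_zero, mul_zero, sub_zero] at this
    rw [← this]; ring
  set Z : ℝ → ℂ := fun t => ∑ j, (x j t - v * t) ^ 2
  have hZ : ∀ t, HasDerivAt Z (G t) t := fun t => by
    have : ∀ j, HasDerivAt (fun t => (x j t - v * t) ^ 2)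
        (2 * (x j t - v * t) * (deriv (x j) t - v)) t := fun j => by
      refine (((h.differentiable j t).hasDerivAt.sub ((hid t).const_mul (v : ℂ))).pow 2).congr_deriv ?_
      simp
    refine (HasDerivAt.fun_sum fun j _ => this j).congr_deriv ?_
    simp only [G, F, Finset.mul_sum, mul_add, mul_sub]
    rw [show (2 : ℂ) * (N * v ^ 2 * t) = ∑ _j : Fin N, 2 * (v : ℂ) ^ 2 * t by
      simp; ring]
    rw [← Finset.sum_sub_distrib, ← Finset.sum_sub_distrib, ← Finset.sum_add_distrib]
    exact Finset.sum_congr rfl fun j _ => by ring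
  have hZ1 : ∀ t, Z t = Z 0 + G 0 * t + κ 0 * (t : ℂ) ^ 2 := fun t => by
    have : ∀ t, HasDerivAt (fun t => Z t - G 0 * t - κ 0 * (t : ℂ) ^ 2) 0 t := fun t => by
      refine (((hZ t).sub ((hid t).const_mul _)).sub (((hid t).pow 2).const_mul _)).congr_deriv ?_
      rw [hG1]
      simp
      ring
    have := eq_of_hasDerivAt_zero this t 0
    simp only [Complex.ofReal_zero, mul_zero, sub_zero, ne_eq, OfNat.ofNat_ne_zero,
      not_false_eq_true, zero_pow] at this
    rw [← this]; ring
  have h0 : κ 0 = 0 := by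
    refine eq_zero_of_quadratic_bounded (a := Z 0) (b := G 0) (R := N * R ^ 2) hτ fun n => ?_
    rw [← hZ1]
    refine (norm_sum_le _ _).trans ?_
    refine (Finset.sum_le_card_nsmul _ _ (R ^ 2) fun j _ => ?_).trans (by simp)
    rw [norm_pow]
    exact pow_le_pow_left₀ (norm_nonneg _) (hb n j) 2
  rw [← h0, ← eq_of_hasDerivAt_zero hκ' t 0]

/-- Once S_j S_k = 0 for j ≠ k, every commutator in the spin equation vanishes, so the spins are
constant. -/
theorem travelling (h : IsSpinFlow M₀ S x) {v R : ℝ} {τ : ℕ → ℝ}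
    (hτ : Tendsto τ atTop atTop) (hb : ∀ n j, ‖x j (τ n) - v * τ n‖ ≤ R) :
    (∀ j t, x j t = x j 0 + v * t) ∧ (∀ j t, S j t = S j 0) ∧
      ∀ t j k, j ≠ k → S j t * S k t = 0 := by
  have hr := fun t => h.rigidity (h.laxEnergy_eq_of_bounded hτ hb t)
  refine ⟨fun j t => ?_, fun j t => ?_, fun t => (hr t).2⟩
  · have : ∀ t, HasDerivAt (fun t => x j t - v * t) 0 t := fun t => by
      refine ((h.differentiable j t).hasDerivAt.sub
        ((Complex.ofRealCLM.hasDerivAt (x := t)).const_mul (v : ℂ))).congr_deriv ?_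
      rw [(hr t).1 j]
      simp
    have := eq_of_hasDerivAt_zero this t 0
    simp only [Complex.ofReal_zero, mul_zero, sub_zero] at this
    rw [← this]; ring
  · ext a b
    refine eq_of_hasDerivAt_zero (f := fun t => S j t a b) (fun t => ?_) t 0
    refine (h.spin j t a b).congr_deriv ?_
    rw [Finset.sum_mul, Finset.mul_sum, Finset.sum_eq_zero, Finset.sum_eq_zero, sub_self]
    · rfl
    · intro k _
      split_ifs with hk
      · simp
      · rw [Matrix.mul_smul, (hr t).2 j k (Ne.symm hk), smul_zero]
    · intro k _
      split_ifs with hk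
      · simp
      · rw [Matrix.smul_mul, (hr t).2 k j hk, smul_zero]

end IsSpinFlow

/-! ### Analytic continuation and comparison of polar parts. -/

/-- The complement of a finite set in ℂ is connected, so the identity theorem carries relations from
the real line to neighbourhoods of the poles. -/
theorem eq_zero_of_real_eq_zero {F : ℂ → ℂ} {P : Set ℂ} (hP : P.Finite)
    (hd : DifferentiableOn ℂ F Pᶜ) (h : ∀ x : ℝ, (x : ℂ) ∉ P → F x = 0) {z : ℂ} (hz : z ∉ P) :
    F z = 0 := by
  have ho : IsOpen Pᶜ := hP.isClosed.isOpen_compl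
  have hconn : IsPreconnected Pᶜ :=
    (hP.countable.isConnected_compl_of_one_lt_rank (by simp)).isPreconnected
  obtain ⟨x₀, hx₀⟩ : ∃ x : ℝ, (x : ℂ) ∉ P := by
    by_contra! hc
    exact (Set.infinite_range_of_injective Complex.ofReal_injective)
      (hP.subset (Set.range_subset_iff.2 hc))
  refine (hd.analyticOnNhd ho).eqOn_of_preconnected_of_frequently_eq (g := 0)
    analyticOnNhd_const hconn hx₀ ?_ hz
  have h1 : Tendsto (fun x : ℝ => (x : ℂ)) (𝓝[≠] x₀) (𝓝[≠] (x₀ : ℂ)) :=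
    tendsto_nhdsWithin_of_tendsto_nhds_of_eventually_within _
      ((Complex.continuous_ofReal.tendsto x₀).mono_left nhdsWithin_le_nhds)
      (by filter_upwards [self_mem_nhdsWithin] with x hx; simpa using hx)
  refine h1.frequently (Eventually.frequently ?_)
  have : ∀ᶠ x : ℝ in 𝓝 x₀, (x : ℂ) ∈ Pᶜ :=
    (Complex.continuous_ofReal.tendsto x₀).eventually (ho.mem_nhds hx₀)
  filter_upwards [nhdsWithin_le_nhds this] with x hx using h x hx

theorem eq_zero_and_deriv_eq_zero {f : ℂ → ℂ} {f' p : ℂ} (hf : HasDerivAt f f' p)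
    (h : ∀ᶠ z in 𝓝[≠] p, f z = 0) : f p = 0 ∧ f' = 0 := by
  have h0 : f p = 0 := tendsto_nhds_unique (hf.continuousAt.tendsto.mono_left nhdsWithin_le_nhds)
    (tendsto_const_nhds.congr' (h.mono fun z hz => hz.symm))
  refine ⟨h0, hf.unique ((hasDerivAt_const p (0 : ℂ)).congr_of_eventuallyEq ?_)⟩
  rw [eventually_nhdsWithin_iff] at h
  filter_upwards [h] with z hz
  rcases eq_or_ne z p with rfl | hzp
  · exact h0
  · exact hz hzp

theorem cross_apply_cyclic {R : Type*} [CommRing R] (u v : Fin 3 → R) (i : Fin 3) :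
    (u ⨯₃ v) i = u (i + 1) * v (i + 2) - u (i + 2) * v (i + 1) := by
  fin_cases i <;> simp [cross_apply]

/-- These are the coefficients of (z - p)⁻² and (z - p)⁻¹: multiply by (z - p)² and read off the
value and the derivative at p. -/
theorem sphere_pole {s : Fin 3 → ℂ} {A : Fin 3 → ℂ → ℂ} {p : ℂ}
    (hA : ∀ i, DifferentiableAt ℂ (A i) p)
    (h : ∀ᶠ z in 𝓝[≠] p, ∑ i, (s i / (z - p) + A i z) ^ 2 = 1) :
    ∑ i, s i ^ 2 = 0 ∧ ∑ i, s i * A i p = 0 := by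
  have hd : HasDerivAt (fun z => ∑ i, (s i + (z - p) * A i z) ^ 2 - (z - p) ^ 2)
      (∑ i, 2 * (s i + (p - p) * A i p) * (1 * A i p + (p - p) * deriv (A i) p) -
        2 * (p - p) * 1) p := by
    refine HasDerivAt.sub (HasDerivAt.fun_sum fun i _ => ?_) ?_
    · refine ((((hasDerivAt_id p).sub_const p).mul (hA i).hasDerivAt).const_add (s i)).pow 2
        |>.congr_deriv ?_
      simp
    · refine (((hasDerivAt_id p).sub_const p).pow 2).congr_deriv ?_
      simp
  obtain ⟨h1, h2⟩ := eq_zero_and_deriv_eq_zero hd (by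
    filter_upwards [h, self_mem_nhdsWithin] with z hz hzp
    have hzp' : z - p ≠ 0 := sub_ne_zero.2 hzp
    rw [sub_eq_zero, ← one_mul ((z - p) ^ 2), ← hz, Finset.sum_mul]
    refine Finset.sum_congr rfl fun i _ => ?_
    rw [← mul_pow]
    field_simp)
  constructor
  · simpa using h1
  · simpa [mul_assoc, ← Finset.mul_sum] using h2

/-- On the right the triple pole drops out because s × s = 0. After multiplication by (z - p)², the
value and the derivative at p give the two identities. -/
theorem evolution_pole {s a b A' : Fin 3 → ℂ} {A R W : Fin 3 → ℂ → ℂ} {p : ℂ}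
    (hA : ∀ i, HasDerivAt (A i) (A' i) p) (hW : ∀ i, DifferentiableAt ℂ (W i) p)
    (hR : ∀ i, DifferentiableAt ℂ (R i) p) (i : Fin 3)
    (h : ∀ᶠ z in 𝓝[≠] p, b i / (z - p) + a i / (z - p) ^ 2 + R i z =
      (s (i + 1) / (z - p) + A (i + 1) z) * (-Complex.I * s (i + 2) / (z - p) ^ 2 + W (i + 2) z) -
      (s (i + 2) / (z - p) + A (i + 2) z) * (-Complex.I * s (i + 1) / (z - p) ^ 2 + W (i + 1) z)) :
    a i = -Complex.I * (A (i + 1) p * s (i + 2) - A (i + 2) p * s (i + 1)) ∧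
    b i = (s (i + 1) * W (i + 2) p - s (i + 2) * W (i + 1) p) -
      Complex.I * (A' (i + 1) * s (i + 2) - A' (i + 2) * s (i + 1)) := by
  have hid : HasDerivAt (fun z => z - p) 1 p := (hasDerivAt_id p).sub_const p
  have hd : HasDerivAt (fun z => (a i + (z - p) * b i + (z - p) * ((z - p) * R i z)) -
      ((z - p) * (s (i + 1) * W (i + 2) z - s (i + 2) * W (i + 1) z) -
        Complex.I * (A (i + 1) z * s (i + 2) - A (i + 2) z * s (i + 1)) +
        (z - p) * ((z - p) * (A (i + 1) z * W (i + 2) z - A (i + 2) z * W (i + 1) z))))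
      (b i - ((s (i + 1) * W (i + 2) p - s (i + 2) * W (i + 1) p) -
      Complex.I * (A' (i + 1) * s (i + 2) - A' (i + 2) * s (i + 1)))) p := by
    have hW' := fun i => (hW i).hasDerivAt
    refine ((((hid.mul_const (b i)).const_add (a i)).add
      (hid.mul (hid.mul (hR i).hasDerivAt))).sub (((hid.mul (((hW' (i + 2)).const_mul (s (i + 1))).sub
        ((hW' (i + 1)).const_mul (s (i + 2))))).sub
        ((((hA (i + 1)).mul_const (s (i + 2))).sub
          ((hA (i + 2)).mul_const (s (i + 1)))).const_mul Complex.I)).add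
        (hid.mul (hid.mul (((hA (i + 1)).mul (hW' (i + 2))).sub
          ((hA (i + 2)).mul (hW' (i + 1)))))))).congr_deriv ?_
    simp only [Pi.mul_apply, Pi.sub_apply, sub_self]
    ring
  obtain ⟨h1, h2⟩ := eq_zero_and_deriv_eq_zero hd (by
    filter_upwards [h, self_mem_nhdsWithin] with z hz hzp
    have hzp' : z - p ≠ 0 := sub_ne_zero.2 hzp
    have e : (z - p) ^ 2 * (b i / (z - p) + a i / (z - p) ^ 2 + R i z) =
      a i + (z - p) * b i + (z - p) * ((z - p) * R i z) := by
      field_simp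
      ring
    rw [← e, hz]
    field_simp
    ring)
  constructor
  · simp only [sub_self, zero_mul, add_zero, zero_sub] at h1
    linear_combination h1
  · exact sub_eq_zero.1 h2

/-! ### The Hilbert transform of a double pole. -/

theorem ofReal_sub_ne_zero {a : ℂ} (ha : a.im ≠ 0) (y : ℝ) : (y : ℂ) - a ≠ 0 := fun h => by
  have := congrArg Complex.im h
  simp [ha] at this

theorem integrable_inv_normSq_sub {a : ℂ} (ha : a.im ≠ 0) :
    Integrable fun y : ℝ => ‖(y : ℂ) - a‖⁻¹ ^ 2 := by
  have h1 := ((integrable_inv_one_add_sq.comp_div ha).comp_sub_right a.re).const_mul ((a.im ^ 2)⁻¹)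
  refine h1.congr (Eventually.of_forall fun y => ?_)
  have h2 : ‖(y : ℂ) - a‖ ^ 2 = (y - a.re) ^ 2 + a.im ^ 2 := by
    rw [← Complex.normSq_eq_norm_sq, Complex.normSq_apply]
    simp
    ring
  simp only
  rw [inv_pow, h2, ← mul_inv]
  congr 1
  field_simp
  ring

theorem integrableOn_hilbertKernel {a : ℂ} (ha : a.im ≠ 0) (x : ℝ) {ε : ℝ} (hε : 0 < ε) :
    IntegrableOn (fun y : ℝ => ((x : ℂ) - y)⁻¹ * (((y : ℂ) - a) ^ 2)⁻¹) {y | ε < |x - y|} := by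
  have hm : MeasurableSet {y : ℝ | ε < |x - y|} :=
    measurableSet_lt measurable_const (by fun_prop)
  refine Integrable.mono' ((integrable_inv_normSq_sub ha).const_mul ε⁻¹).integrableOn
    (by fun_prop) ?_
  filter_upwards [ae_restrict_mem hm] with y hy
  rw [norm_mul, norm_inv, norm_inv, norm_pow, inv_pow]
  refine mul_le_mul_of_nonneg_right ?_ (by positivity)
  refine inv_anti₀ hε ?_
  rw [← Complex.ofReal_sub, Complex.norm_real]
  have hy' : ε < |x - y| := hy
  exact hy'.le

/-- A primitive of `y ↦ (x - y)⁻¹ * (y - a)⁻²`. -/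
noncomputable def hilbertPrimitive (a : ℂ) (x y : ℝ) : ℂ :=
  (((x : ℂ) - a) ^ 2)⁻¹ * (Complex.log (y - a) - Real.log (x - y)) -
    ((x : ℂ) - a)⁻¹ * ((y : ℂ) - a)⁻¹

theorem hasDerivAt_hilbertPrimitive {a : ℂ} (ha : a.im ≠ 0) {x y : ℝ} (hxy : x ≠ y) :
    HasDerivAt (hilbertPrimitive a x) (((x : ℂ) - y)⁻¹ * (((y : ℂ) - a) ^ 2)⁻¹) y := by
  have hid : HasDerivAt (fun y : ℝ => (y : ℂ) - a) 1 y :=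
    (Complex.ofRealCLM.hasDerivAt (x := y)).sub_const a
  have hslit : (y : ℂ) - a ∈ Complex.slitPlane := Or.inr (by simpa using ha)
  have h1 := hid.clog_real hslit
  have h2 : HasDerivAt (fun y : ℝ => ((Real.log (x - y) : ℝ) : ℂ)) (((-1 / (x - y) : ℝ)) : ℂ) y := by
    refine HasDerivAt.ofReal_comp ?_
    simpa using ((hasDerivAt_id y).const_sub x).log (sub_ne_zero.2 hxy)
  have h3 := hid.fun_inv (ofReal_sub_ne_zero ha y)
  refine (((h1.sub h2).const_mul _).sub (h3.const_mul _)).congr_deriv ?_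
  have e1 := ofReal_sub_ne_zero ha y
  have e2 := ofReal_sub_ne_zero ha x
  have e3 : (x : ℂ) - y ≠ 0 := sub_ne_zero.2 (by exact_mod_cast hxy)
  push_cast
  field_simp
  ring

theorem tendsto_inv_ofReal_sub_atTop (a : ℂ) :
    Tendsto (fun y : ℝ => ((y : ℂ) - a)⁻¹) atTop (𝓝 0) := by
  refine tendsto_inv₀_cobounded.comp ?_
  rw [← tendsto_norm_atTop_iff_cobounded]
  refine tendsto_atTop_mono (fun y => ?_) (tendsto_atTop_add_const_right _ (-‖a‖) tendsto_id)
  have := norm_sub_norm_le (y : ℂ) a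
  rw [Complex.norm_real] at this
  have := le_abs_self y
  simp only [id, Real.norm_eq_abs] at *
  linarith

theorem tendsto_inv_ofReal_sub_atBot (a : ℂ) :
    Tendsto (fun y : ℝ => ((y : ℂ) - a)⁻¹) atBot (𝓝 0) := by
  have := ((tendsto_inv_ofReal_sub_atTop (-a)).comp tendsto_neg_atBot_atTop).neg
  rw [neg_zero] at this
  refine this.congr fun y => ?_
  simp only [Function.comp, Complex.ofReal_neg]
  rw [← inv_neg]
  congr 1
  ring

theorem tendsto_ofReal_inv_atTop (a : ℂ) : Tendsto (fun y : ℝ => a * (y : ℂ)⁻¹) atTop (𝓝 0) := by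
  simpa using (tendsto_inv_ofReal_sub_atTop 0).const_mul a

theorem tendsto_log_sub_log_atTop {a : ℂ} (ha : a.im ≠ 0) (x : ℝ) :
    Tendsto (fun y : ℝ => Complex.log (y - a) - Real.log (x - y)) atTop (𝓝 0) := by
  have h1 : Tendsto (fun y : ℝ => Complex.log (1 - a * (y : ℂ)⁻¹)) atTop (𝓝 0) := by
    have := (tendsto_ofReal_inv_atTop a).const_sub 1
    rw [sub_zero] at this
    simpa using this.clog (Or.inl (by simp))
  have h2 : Tendsto (fun y : ℝ => Real.log (1 - x * y⁻¹)) atTop (𝓝 0) := by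
    have := (tendsto_inv_atTop_zero.const_mul x).const_sub 1
    rw [mul_zero, sub_zero] at this
    simpa using this.log one_ne_zero
  have h3 := h1.sub ((Complex.continuous_ofReal.tendsto 0).comp h2)
  rw [Complex.ofReal_zero, sub_zero] at h3
  refine h3.congr' ?_
  filter_upwards [eventually_gt_atTop 0, eventually_gt_atTop x] with y hy hxy
  have hy' : (y : ℂ) ≠ 0 := by exact_mod_cast hy.ne'
  have e1 : (y : ℂ) - a = y * (1 - a * (y : ℂ)⁻¹) := by field_simp
  have e2 : x - y = -(y * (1 - x * y⁻¹)) := by field_simp; ring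
  have n1 : 1 - a * (y : ℂ)⁻¹ ≠ 0 := fun h => ofReal_sub_ne_zero ha y (by rw [e1, h, mul_zero])
  have n2 : 1 - x * y⁻¹ ≠ 0 := fun h => (sub_neg.2 hxy).ne (by rw [e2, h]; simp)
  rw [e1, e2, Complex.log_ofReal_mul hy n1, Real.log_neg_eq_log, Real.log_mul hy.ne' n2]
  simp

/-- Here y - a lies in the lower half plane, so its argument tends to -π. This limit is the source
of the factor i in the Hilbert transform. -/
theorem tendsto_log_sub_log_atBot {a : ℂ} (ha : 0 < a.im) (x : ℝ) :
    Tendsto (fun y : ℝ => Complex.log (y - a) - Real.log (x - y)) atBot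
      (𝓝 (-(Real.pi * Complex.I))) := by
  have h1 : Tendsto (fun y : ℝ => Complex.log (-1 - a * (y : ℂ)⁻¹)) atTop
      (𝓝 (-(Real.pi * Complex.I))) := by
    have h := (tendsto_ofReal_inv_atTop a).const_sub (-1)
    rw [sub_zero] at h
    have h' := Complex.tendsto_log_nhdsWithin_im_neg_of_re_neg_of_im_zero (z := -1)
      (by simp) (by simp)
    simp only [norm_neg, norm_one, Real.log_one, Complex.ofReal_zero, zero_sub] at h'
    refine h'.comp (tendsto_nhdsWithin_of_tendsto_nhds_of_eventually_within _ h ?_)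
    filter_upwards [eventually_gt_atTop 0] with y hy
    rw [← Complex.ofReal_inv]
    simp [Complex.mul_im]
    positivity
  have h2 : Tendsto (fun y : ℝ => Real.log (1 + x * y⁻¹)) atTop (𝓝 0) := by
    have := (tendsto_inv_atTop_zero.const_mul x).const_add 1
    rw [mul_zero, add_zero] at this
    simpa using this.log one_ne_zero
  have h3 := (h1.sub ((Complex.continuous_ofReal.tendsto 0).comp h2)).comp
    tendsto_neg_atBot_atTop
  rw [Complex.ofReal_zero, sub_zero] at h3
  refine h3.congr' ?_
  filter_upwards [eventually_lt_atBot 0, eventually_lt_atBot x] with z hz hxz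
  obtain ⟨y, rfl⟩ : ∃ y, z = -y := ⟨-z, by simp⟩
  have hy : 0 < y := by linarith
  have hy' : (y : ℂ) ≠ 0 := by exact_mod_cast hy.ne'
  have e1 : ((-y : ℝ) : ℂ) - a = y * (-1 - a * (y : ℂ)⁻¹) := by push_cast; field_simp
  have e2 : x - -y = y * (1 + x * y⁻¹) := by field_simp; ring
  have n1 : -1 - a * (y : ℂ)⁻¹ ≠ 0 := fun h =>
    ofReal_sub_ne_zero ha.ne' (-y) (by rw [e1, h, mul_zero])
  have n2 : 1 + x * y⁻¹ ≠ 0 := fun h => (sub_pos.2 hxz).ne' (by rw [e2, h]; simp)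
  rw [e1, e2, Complex.log_ofReal_mul hy n1, Real.log_mul hy.ne' n2]
  simp

theorem integral_hilbertKernel {a : ℂ} (ha : 0 < a.im) (x : ℝ) {ε : ℝ} (hε : 0 < ε) :
    ∫ y in {y : ℝ | ε < |x - y|}, ((x : ℂ) - y)⁻¹ * (((y : ℂ) - a) ^ 2)⁻¹ =
      hilbertPrimitive a x (x - ε) - hilbertPrimitive a x (x + ε) +
        Real.pi * (Complex.I / ((x : ℂ) - a) ^ 2) := by
  have hset : {y : ℝ | ε < |x - y|} = Set.Iio (x - ε) ∪ Set.Ioi (x + ε) := by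
    ext y
    simp only [Set.mem_ofPred_eq, lt_abs, Set.mem_union, Set.mem_Iio, Set.mem_Ioi]
    constructor <;> rintro (h | h) <;> [left; right; left; right] <;> linarith
  have hint := integrableOn_hilbertKernel ha.ne' x hε
  rw [hset] at hint ⊢
  have hl := hint.mono_set Set.subset_union_left
  have hr := hint.mono_set Set.subset_union_right
  rw [setIntegral_union (Set.disjoint_left.2 fun y h1 h2 => by
    simp only [Set.mem_Iio, Set.mem_Ioi] at h1 h2; linarith) measurableSet_Ioi hl hr,
    ← integral_Iic_eq_integral_Iio]
  rw [integral_Iic_of_hasDerivAt_of_tendsto'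
      (fun y hy => hasDerivAt_hilbertPrimitive ha.ne' (by rintro rfl; simp at hy; linarith))
      ((integrableOn_Iic_iff_integrableOn_Iio enorm_ne_top).2 hl)
      (((tendsto_log_sub_log_atBot ha x).const_mul _).sub
        ((tendsto_inv_ofReal_sub_atBot a).const_mul _)),
    integral_Ioi_of_hasDerivAt_of_tendsto'
      (fun y hy => hasDerivAt_hilbertPrimitive ha.ne' (by rintro rfl; simp at hy; linarith)) hr
      (((tendsto_log_sub_log_atTop ha.ne' x).const_mul _).sub
        ((tendsto_inv_ofReal_sub_atTop a).const_mul _))]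
  ring

theorem tendsto_hilbertKernel {a : ℂ} (ha : 0 < a.im) (x : ℝ) :
    Tendsto (fun ε : ℝ => (Real.pi : ℂ)⁻¹ * ∫ y in {y : ℝ | ε < |x - y|},
      ((x : ℂ) - y)⁻¹ * (((y : ℂ) - a) ^ 2)⁻¹) (𝓝[>] 0) (𝓝 (Complex.I / ((x : ℂ) - a) ^ 2)) := by
  -- At x - ε and x + ε the real logarithms are both log ε and cancel; what remains of the primitive
  -- is continuous at x.
  set Φ : ℝ → ℂ := fun y => (((x : ℂ) - a) ^ 2)⁻¹ * Complex.log (y - a) -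
    ((x : ℂ) - a)⁻¹ * ((y : ℂ) - a)⁻¹
  have hΦ : Continuous Φ := by
    refine (continuous_const.mul (Continuous.clog (by fun_prop) fun y => Or.inr ?_)).sub
      (continuous_const.mul (Continuous.inv₀ (by fun_prop) fun y => ofReal_sub_ne_zero ha.ne' y))
    simpa using ha.ne'
  have h1 : Tendsto (fun ε : ℝ => (Real.pi : ℂ)⁻¹ * (Φ (x - ε) - Φ (x + ε) +
      Real.pi * (Complex.I / ((x : ℂ) - a) ^ 2))) (𝓝[>] 0) (𝓝 (Complex.I / ((x : ℂ) - a) ^ 2)) := by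
    have hc : Continuous fun ε : ℝ => (Real.pi : ℂ)⁻¹ * (Φ (x - ε) - Φ (x + ε) +
      Real.pi * (Complex.I / ((x : ℂ) - a) ^ 2)) := by fun_prop
    have := (hc.tendsto 0).mono_left (nhdsWithin_le_nhds (s := Set.Ioi 0))
    have hpi : (Real.pi : ℂ) ≠ 0 := by exact_mod_cast Real.pi_ne_zero
    simpa [hpi] using this
  refine h1.congr' ?_
  filter_upwards [self_mem_nhdsWithin] with ε hε
  rw [integral_hilbertKernel ha x hε]
  simp only [Φ, hilbertPrimitive, sub_sub_cancel, sub_add_cancel_left, Real.log_neg_eq_log]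
  ring

theorem tendsto_hilbertKernel_conj {a : ℂ} (ha : 0 < a.im) (x : ℝ) :
    Tendsto (fun ε : ℝ => (Real.pi : ℂ)⁻¹ * ∫ y in {y : ℝ | ε < |x - y|},
      ((x : ℂ) - y)⁻¹ * (((y : ℂ) - conj a) ^ 2)⁻¹) (𝓝[>] 0)
      (𝓝 (-Complex.I / ((x : ℂ) - conj a) ^ 2)) := by
  have h := (Complex.continuous_conj.tendsto _).comp (tendsto_hilbertKernel ha x)
  simp only [map_div₀, Complex.conj_I, map_pow, map_sub, Complex.conj_ofReal] at h
  refine h.congr fun ε => ?_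
  simp only [Function.comp, map_mul, map_inv₀, Complex.conj_ofReal]
  rw [← integral_conj]
  simp

theorem HasHilbertTransformAt.eq_of_rational {N : ℕ} {f : ℝ → Fin 3 → ℝ} {w : Fin 3 → ℝ} {x : ℝ}
    (h : HasHilbertTransformAt f w x) {s : Fin N → Fin 3 → ℂ} {p : Fin N → ℂ}
    (hp : ∀ j, 0 < (p j).im)
    (hf : ∀ y i, (f y i : ℂ) = -(∑ j, s j i * (((y : ℂ) - p j) ^ 2)⁻¹) -
      ∑ j, conj (s j i) * (((y : ℂ) - conj (p j)) ^ 2)⁻¹) (i : Fin 3) :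
    (w i : ℂ) = -(∑ j, s j i * (Complex.I / ((x : ℂ) - p j) ^ 2)) -
      ∑ j, conj (s j i) * (-Complex.I / ((x : ℂ) - conj (p j)) ^ 2) := by
  have h1 : Tendsto (fun ε : ℝ => -(∑ j, s j i * ((Real.pi : ℂ)⁻¹ * ∫ y in {y : ℝ | ε < |x - y|},
      ((x : ℂ) - y)⁻¹ * (((y : ℂ) - p j) ^ 2)⁻¹)) -
      ∑ j, conj (s j i) * ((Real.pi : ℂ)⁻¹ * ∫ y in {y : ℝ | ε < |x - y|},
      ((x : ℂ) - y)⁻¹ * (((y : ℂ) - conj (p j)) ^ 2)⁻¹)) (𝓝[>] 0) (𝓝 _) :=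
    (tendsto_finsetSum _ fun j _ => (tendsto_hilbertKernel (hp j) x).const_mul (s j i)).neg.sub
      (tendsto_finsetSum _ fun j _ => (tendsto_hilbertKernel_conj (hp j) x).const_mul (conj (s j i)))
  have h2 := (Complex.continuous_ofReal.tendsto _).comp ((tendsto_pi_nhds.1 h.2) i)
  refine tendsto_nhds_unique (h2.congr' ?_) h1
  filter_upwards [self_mem_nhdsWithin] with ε hε
  have hi := h.1 ε hε
  simp only [Function.comp, Pi.smul_apply, smul_eq_mul]
  rw [eval_integral (fun i => hi.eval i), Complex.ofReal_mul, ← integral_complex_ofReal]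
  have e : ∀ y : ℝ, ((((x - y)⁻¹ • f y) i : ℝ) : ℂ) =
      -(∑ j, s j i * (((x : ℂ) - y)⁻¹ * (((y : ℂ) - p j) ^ 2)⁻¹)) -
      ∑ j, conj (s j i) * (((x : ℂ) - y)⁻¹ * (((y : ℂ) - conj (p j)) ^ 2)⁻¹) := fun y => by
    simp only [Pi.smul_apply, smul_eq_mul, Complex.ofReal_mul, hf, mul_sub, mul_neg, Finset.mul_sum,
      Complex.ofReal_inv, Complex.ofReal_sub]
    congr 2
    · exact Finset.sum_congr rfl fun j _ => by ring
    · ext j; ring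
  simp_rw [e]
  have i1 := fun j => (integrableOn_hilbertKernel (hp j).ne' x hε).const_mul (s j i)
  have i2 := fun j => (integrableOn_hilbertKernel (a := conj (p j)) (by simpa using (hp j).ne') x
    hε).const_mul (conj (s j i))
  rw [integral_sub (integrable_finsetSum _ fun j _ => i1 j).fun_neg
      (integrable_finsetSum _ fun j _ => i2 j),
    integral_neg, integral_finsetSum _ fun j _ => i1 j, integral_finsetSum _ fun j _ => i2 j]
  simp only [integral_const_mul, mul_sub, mul_neg, Finset.mul_sum, Complex.ofReal_inv]
  congr 2
  · exact Finset.sum_congr rfl fun j _ => by ring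
  · ext j; ring

/-! ### Equations of motion of the poles and spins. -/

theorem differentiableAt_div_sub (c : ℂ) {a z : ℂ} (h : z - a ≠ 0) :
    DifferentiableAt ℂ (fun z => c / (z - a)) z := by
  fun_prop (disch := exact h)

theorem differentiableAt_div_sub_sq (c : ℂ) {a z : ℂ} (h : z - a ≠ 0) :
    DifferentiableAt ℂ (fun z => c / (z - a) ^ 2) z := by
  fun_prop (disch := exact pow_ne_zero 2 h)

namespace IsRationalSolution

variable {N : ℕ} {m : ℝ → ℝ → Fin 3 → ℝ} {m₀ : Fin 3 → ℝ}
  {s : Fin N → ℝ → Fin 3 → ℂ} {p : Fin N → ℝ → ℂ}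

theorem pole_ne_conj (hm : IsRationalSolution m m₀ s p) (t : ℝ) (j k : Fin N) :
    p j t ≠ conj (p k t) := fun e => by
  have := congrArg Complex.im e
  simp at this
  linarith [hm.pole_im_pos j t, hm.pole_im_pos k t]

theorem real_sub_ne_zero (hm : IsRationalSolution m m₀ s p) (t x : ℝ) (j : Fin N) :
    (x : ℂ) - p j t ≠ 0 := ofReal_sub_ne_zero (hm.pole_im_pos j t).ne' x

theorem real_sub_conj_ne_zero (hm : IsRationalSolution m m₀ s p) (t x : ℝ) (j : Fin N) :
    (x : ℂ) - conj (p j t) ≠ 0 :=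
  ofReal_sub_ne_zero (by simpa using (hm.pole_im_pos j t).ne') x

theorem deriv_space (hm : IsRationalSolution m m₀ s p) (t x : ℝ) (i : Fin 3) :
    (deriv (m t) x i : ℂ) = -(∑ j, s j t i * (((x : ℂ) - p j t) ^ 2)⁻¹) -
      ∑ j, conj (s j t i) * (((x : ℂ) - conj (p j t)) ^ 2)⁻¹ := by
  have h1 : HasDerivAt (fun x => (m t x i : ℂ)) (deriv (m t) x i : ℂ) x :=
    (hasDerivAt_pi.1 (hm.solution.differentiable_space t x).hasDerivAt i).ofReal_comp
  refine h1.unique ?_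
  simp only [hm.rational t _ i, rationalMap]
  have hid : ∀ a : ℂ, HasDerivAt (fun y : ℝ => (y : ℂ) - a) 1 x := fun a =>
    (Complex.ofRealCLM.hasDerivAt (x := x)).sub_const a
  refine (((HasDerivAt.fun_sum fun j _ => (hasDerivAt_const x (s j t i)).fun_div (hid (p j t))
    (hm.real_sub_ne_zero t x j)).const_add (m₀ i : ℂ)).add
    (HasDerivAt.fun_sum fun j _ => (hasDerivAt_const x (conj (s j t i))).fun_div
      (hid (conj (p j t))) (hm.real_sub_conj_ne_zero t x j))).congr_deriv ?_
  simp [div_eq_mul_inv, sub_eq_add_neg]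

theorem deriv_time (hm : IsRationalSolution m m₀ s p) (t x : ℝ) (i : Fin 3) {w : ℝ}
    (hw : HasDerivAt (fun τ => m τ x i) w t) :
    (w : ℂ) = (∑ j, (deriv (s j) t i / ((x : ℂ) - p j t) +
        s j t i * deriv (p j) t / ((x : ℂ) - p j t) ^ 2)) +
      ∑ j, (conj (deriv (s j) t i) / ((x : ℂ) - conj (p j t)) +
        conj (s j t i * deriv (p j) t) / ((x : ℂ) - conj (p j t)) ^ 2) := by
  refine hw.ofReal_comp.unique ?_
  simp only [hm.rational _ x i, rationalMap]
  have hs : ∀ j, HasDerivAt (fun τ => s j τ i) (deriv (s j) t i) t := fun j =>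
    hasDerivAt_pi.1 (hm.spin_differentiable j t).hasDerivAt i
  have hp : ∀ j, HasDerivAt (p j) (deriv (p j) t) t := fun j =>
    (hm.pole_differentiable j t).hasDerivAt
  refine (((HasDerivAt.fun_sum fun j _ => (hs j).fun_div ((hp j).const_sub (x : ℂ))
    (hm.real_sub_ne_zero t x j)).const_add (m₀ i : ℂ)).add
    (HasDerivAt.fun_sum fun j _ => (hs j).star.fun_div ((hp j).star.const_sub (x : ℂ))
      (hm.real_sub_conj_ne_zero t x j))).congr_deriv ?_
  congr 1 <;> refine Finset.sum_congr rfl fun j _ => ?_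
  · have := hm.real_sub_ne_zero t x j
    field_simp
    ring
  · have := hm.real_sub_conj_ne_zero t x j
    simp only [RCLike.star_def, map_mul] at this ⊢
    field_simp
    ring

theorem sum_eq_add_sum_ite {ι : Type*} [Fintype ι] [DecidableEq ι] (f : ι → ℂ) (j : ι) :
    ∑ k, f k = f j + ∑ k, if k = j then 0 else f k := by
  rw [← Finset.add_sum_erase _ _ (Finset.mem_univ j), Finset.sum_ite, Finset.sum_const_zero, zero_add]
  congr 1
  exact Finset.sum_congr (by ext; simp) fun _ _ => rfl

/-- The value at the pole `p j` of the solution without its `j`-th polar term. -/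
noncomputable def regularPart (m₀ : Fin 3 → ℝ) (s : Fin N → ℝ → Fin 3 → ℂ) (p : Fin N → ℝ → ℂ)
    (j : Fin N) (t : ℝ) (i : Fin 3) : ℂ :=
  m₀ i + (∑ k, if k = j then 0 else s k t i / (p j t - p k t)) +
    ∑ k, conj (s k t i) / (p j t - conj (p k t))

/-- The solution, its half-derivative and its time derivative extend to rational functions M, V and
T. The relations M · M = 1 and T = M × V extend off the poles, and their Laurent coefficients at p_j
are compared. -/
theorem pole_equations (hm : IsRationalSolution m m₀ s p) (j : Fin N) (t : ℝ) :
    (∑ i, s j t i ^ 2 = 0 ∧ ∑ i, s j t i * regularPart m₀ s p j t i = 0) ∧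
    ∀ i, s j t i * deriv (p j) t =
      -Complex.I * (regularPart m₀ s p j t (i + 1) * s j t (i + 2) -
        regularPart m₀ s p j t (i + 2) * s j t (i + 1)) ∧
      deriv (s j) t i = -2 * Complex.I *
        (s j t (i + 1) * (∑ k, if k = j then 0 else s k t (i + 2) / (p j t - p k t) ^ 2) -
         s j t (i + 2) * (∑ k, if k = j then 0 else s k t (i + 1) / (p j t - p k t) ^ 2)) := by
  set P : Set ℂ := Set.range (fun k => p k t) ∪ Set.range (fun k => conj (p k t)) with hP
  have hPfin : P.Finite := (Set.finite_range _).union (Set.finite_range _)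
  have hP1 : ∀ z ∉ P, ∀ k, z - p k t ≠ 0 := fun z hz k h =>
    hz (Or.inl ⟨k, (sub_eq_zero.1 h).symm⟩)
  have hP2 : ∀ z ∉ P, ∀ k, z - conj (p k t) ≠ 0 := fun z hz k h =>
    hz (Or.inr ⟨k, (sub_eq_zero.1 h).symm⟩)
  have hnear : ∀ᶠ z in 𝓝[≠] p j t, z ∉ P := by
    have := (hPfin.subset Set.sdiff_subset : (P \ {p j t}).Finite).isClosed.isOpen_compl.mem_nhds
      (x := p j t) (by simp)
    filter_upwards [nhdsWithin_le_nhds this, self_mem_nhdsWithin] with z hz hzp hzP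
    exact hz ⟨hzP, hzp⟩
  set M : Fin 3 → ℂ → ℂ := fun i z => m₀ i + (∑ k, s k t i / (z - p k t)) +
    ∑ k, conj (s k t i) / (z - conj (p k t)) with hM
  set V : Fin 3 → ℂ → ℂ := fun i z => -(∑ k, s k t i * (Complex.I / (z - p k t) ^ 2)) -
      ∑ k, conj (s k t i) * (-Complex.I / (z - conj (p k t)) ^ 2) with hV
  set T : Fin 3 → ℂ → ℂ := fun i z => (∑ k, (deriv (s k) t i / (z - p k t) +
        s k t i * deriv (p k) t / (z - p k t) ^ 2)) +
      ∑ k, (conj (deriv (s k) t i) / (z - conj (p k t)) +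
        conj (s k t i * deriv (p k) t) / (z - conj (p k t)) ^ 2) with hT
  have dM : ∀ i, DifferentiableOn ℂ (M i) Pᶜ := fun i z hz => by
    refine DifferentiableAt.differentiableWithinAt (DifferentiableAt.add (DifferentiableAt.const_add _
      (DifferentiableAt.fun_sum fun k _ => ?_)) (DifferentiableAt.fun_sum fun k _ => ?_))
    · exact differentiableAt_div_sub _ (hP1 z hz k)
    · exact differentiableAt_div_sub _ (hP2 z hz k)
  have dV : ∀ i, DifferentiableOn ℂ (V i) Pᶜ := fun i z hz => by
    refine DifferentiableAt.differentiableWithinAt (DifferentiableAt.sub (DifferentiableAt.neg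
      (DifferentiableAt.fun_sum fun k _ => ?_)) (DifferentiableAt.fun_sum fun k _ => ?_))
    · exact (differentiableAt_const _).mul
        (differentiableAt_div_sub_sq _ (hP1 z hz k))
    · exact (differentiableAt_const _).mul
        (differentiableAt_div_sub_sq _ (hP2 z hz k))
  have dT : ∀ i, DifferentiableOn ℂ (T i) Pᶜ := fun i z hz => by
    refine DifferentiableAt.differentiableWithinAt (DifferentiableAt.add
      (DifferentiableAt.fun_sum fun k _ => ?_) (DifferentiableAt.fun_sum fun k _ => ?_))
    · exact (differentiableAt_div_sub _ (hP1 z hz k)).add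
        (differentiableAt_div_sub_sq _ (hP1 z hz k))
    · exact (differentiableAt_div_sub _ (hP2 z hz k)).add
        (differentiableAt_div_sub_sq _ (hP2 z hz k))
  have hMx : ∀ (x : ℝ) i, M i x = m t x i := fun x i => (hm.rational t x i).symm
  have hsphere : ∀ z ∉ P, (∑ i, M i z ^ 2) - 1 = 0 := fun z hz => by
    refine eq_zero_of_real_eq_zero hPfin
      (F := fun z => (∑ i, M i z ^ 2) - 1) ?_ (fun x _ => ?_) hz
    · exact (DifferentiableOn.fun_sum fun i _ => (dM i).pow 2).sub_const 1
    · simp only [hMx]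
      have := congrArg (fun r : ℝ => (r : ℂ)) (hm.solution.sphere t x)
      simp only [dotProduct, Fin.sum_univ_three, Complex.ofReal_add, Complex.ofReal_mul,
        Complex.ofReal_one] at this ⊢
      linear_combination this
  have hevol : ∀ z ∉ P, ∀ i,
      T i z - (M (i + 1) z * V (i + 2) z - M (i + 2) z * V (i + 1) z) = 0 := fun z hz i => by
    refine eq_zero_of_real_eq_zero hPfin (F := fun z =>
      T i z - (M (i + 1) z * V (i + 2) z - M (i + 2) z * V (i + 1) z)) ?_ (fun x _ => ?_) hz
    · exact (dT i).sub (((dM _).mul (dV _)).sub ((dM _).mul (dV _)))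
    · obtain ⟨w, hw, hd⟩ := hm.solution.evolution t x
      have h1 := fun i => hw.eq_of_rational (s := fun k => s k t) (p := fun k => p k t)
        (fun k => hm.pole_im_pos k t) (fun y i => hm.deriv_space t y i) i
      have h2 := hm.deriv_time t x i (hasDerivAt_pi.1 hd i)
      rw [cross_apply_cyclic] at h2
      push_cast at h2
      have hVx : ∀ i, V i x = w i := fun i => (h1 i).symm
      simp only [hMx, hVx]
      rw [h2, sub_eq_zero]
  set A : Fin 3 → ℂ → ℂ := fun i z => m₀ i + (∑ k, if k = j then 0 else s k t i / (z - p k t)) +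
    ∑ k, conj (s k t i) / (z - conj (p k t)) with hA
  set W : Fin 3 → ℂ → ℂ := fun i z =>
    -(∑ k, if k = j then 0 else s k t i * (Complex.I / (z - p k t) ^ 2)) -
      ∑ k, conj (s k t i) * (-Complex.I / (z - conj (p k t)) ^ 2) with hW
  set R : Fin 3 → ℂ → ℂ := fun i z => (∑ k, if k = j then 0 else (deriv (s k) t i / (z - p k t) +
        s k t i * deriv (p k) t / (z - p k t) ^ 2)) +
      ∑ k, (conj (deriv (s k) t i) / (z - conj (p k t)) +
        conj (s k t i * deriv (p k) t) / (z - conj (p k t)) ^ 2) with hR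
  have hj1 : ∀ k, k ≠ j → p j t - p k t ≠ 0 := fun k hk =>
    sub_ne_zero.2 ((hm.pole_injective t).ne (Ne.symm hk))
  have hj2 : ∀ k, p j t - conj (p k t) ≠ 0 := fun k => sub_ne_zero.2 (hm.pole_ne_conj t j k)
  have hMA : ∀ i z, M i z = s j t i / (z - p j t) + A i z := fun i z => by
    simp only [hM, hA]
    rw [sum_eq_add_sum_ite _ j]
    ring
  have hVW : ∀ i z, V i z = -Complex.I * s j t i / (z - p j t) ^ 2 + W i z := fun i z => by
    simp only [hV, hW]
    rw [sum_eq_add_sum_ite _ j]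
    ring
  have hTR : ∀ i z, T i z = deriv (s j) t i / (z - p j t) +
      s j t i * deriv (p j) t / (z - p j t) ^ 2 + R i z := fun i z => by
    simp only [hT, hR]
    rw [sum_eq_add_sum_ite _ j]
    ring
  have dA : ∀ i, HasDerivAt (A i) (-(∑ k, if k = j then 0 else s k t i / (p j t - p k t) ^ 2) -
      ∑ k, conj (s k t i) / (p j t - conj (p k t)) ^ 2) (p j t) := fun i => by
    rw [sub_eq_add_neg, ← Finset.sum_neg_distrib, ← Finset.sum_neg_distrib]
    refine HasDerivAt.add (HasDerivAt.const_add _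
      (HasDerivAt.fun_sum fun k _ => ?_)) (HasDerivAt.fun_sum fun k _ => ?_)
    · split_ifs with hk
      · simpa using hasDerivAt_const (p j t) (0 : ℂ)
      · refine ((hasDerivAt_const (p j t) (s k t i)).fun_div
          ((hasDerivAt_id (p j t)).sub_const (p k t)) (hj1 k hk)).congr_deriv ?_
        simp [neg_div]
    · refine ((hasDerivAt_const (p j t) (conj (s k t i))).fun_div
        ((hasDerivAt_id (p j t)).sub_const (conj (p k t))) (hj2 k)).congr_deriv ?_
      simp [neg_div]
  have dW : ∀ i, DifferentiableAt ℂ (W i) (p j t) := fun i => by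
    refine DifferentiableAt.sub (DifferentiableAt.neg
      (DifferentiableAt.fun_sum fun k _ => ?_)) (DifferentiableAt.fun_sum fun k _ => ?_)
    · split_ifs with hk
      · exact differentiableAt_const _
      · exact (differentiableAt_const _).mul
          (differentiableAt_div_sub_sq _ (hj1 k hk))
    · exact (differentiableAt_const _).mul
        (differentiableAt_div_sub_sq _ (hj2 k))
  have dR : ∀ i, DifferentiableAt ℂ (R i) (p j t) := fun i => by
    refine DifferentiableAt.add
      (DifferentiableAt.fun_sum fun k _ => ?_) (DifferentiableAt.fun_sum fun k _ => ?_)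
    · split_ifs with hk
      · exact differentiableAt_const _
      · exact (differentiableAt_div_sub _ (hj1 k hk)).add
          (differentiableAt_div_sub_sq _ (hj1 k hk))
    · exact (differentiableAt_div_sub _ (hj2 k)).add
        (differentiableAt_div_sub_sq _ (hj2 k))
  refine ⟨sphere_pole (A := A) (fun i => (dA i).differentiableAt) ?_, fun i => ?_⟩
  · filter_upwards [hnear] with z hz
    have := hsphere z hz
    simp only [hMA] at this
    exact sub_eq_zero.1 this
  · have := evolution_pole (s := s j t) (a := fun i => s j t i * deriv (p j) t) (b := deriv (s j) t)
      dA dW dR i (by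
        filter_upwards [hnear] with z hz
        have := hevol z hz i
        simp only [hMA, hVW, hTR] at this
        exact sub_eq_zero.1 this)
    refine ⟨this.1, this.2.trans ?_⟩
    -- The Hilbert transform acts as i on d/dz of the terms with poles p_k and as -i on those with
    -- conjugate poles. Against the A' terms the former double, giving -2i, and the latter cancel.
    have hWp : ∀ i, W i (p j t) =
        -Complex.I * (∑ k, if k = j then 0 else s k t i / (p j t - p k t) ^ 2) +
        Complex.I * ∑ k, conj (s k t i) / (p j t - conj (p k t)) ^ 2 := fun i => by
      simp only [hW, Finset.mul_sum, mul_ite, mul_zero]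
      rw [sub_eq_add_neg, ← Finset.sum_neg_distrib, ← Finset.sum_neg_distrib]
      congr 1 <;> refine Finset.sum_congr rfl fun k _ => ?_
      · split_ifs
        · simp
        · ring
      · ring
    rw [hWp, hWp]
    ring

end IsRationalSolution

/-! ### Pauli matrices and the passage to the spin flow. -/

/-- The Pauli matrix of a complex vector. -/
noncomputable def pauli (a : Fin 3 → ℂ) : Matrix (Fin 2) (Fin 2) ℂ :=
  !![a 2, a 0 - Complex.I * a 1; a 0 + Complex.I * a 1, -a 2]

theorem pauli_commutator (u v : Fin 3 → ℂ) : pauli u * pauli v - pauli v * pauli u =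
    pauli fun i => -2 * Complex.I * (v (i + 1) * u (i + 2) - v (i + 2) * u (i + 1)) := by
  ext a b
  fin_cases a <;> fin_cases b <;> simp [pauli] <;>
    ring_nf <;> simp <;> ring

/-- The product of the Pauli matrices of A and s is A · s plus the Pauli matrix of i A × s; here the
first vanishes and i A × s = -c s. -/
theorem pauli_mul_of_cross {A s : Fin 3 → ℂ} {c : ℂ} (h0 : ∑ i, s i * A i = 0)
    (h : ∀ i, s i * c = -Complex.I * (A (i + 1) * s (i + 2) - A (i + 2) * s (i + 1))) :
    pauli A * pauli s = -c • pauli s := by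
  have e0 := h 0
  have e1 := h 1
  have e2 := h 2
  simp only [Fin.sum_univ_three] at h0
  simp at e0 e1 e2
  ext a b
  fin_cases a <;> fin_cases b <;> simp [pauli, mul_apply, Fin.sum_univ_two]
  · linear_combination h0 + e2 - A 1 * s 1 * Complex.I_sq
  · linear_combination e0 - Complex.I * e1 - (A 0 * s 2 - A 2 * s 0) * Complex.I_sq
  · linear_combination e0 + Complex.I * e1 + (A 0 * s 2 - A 2 * s 0) * Complex.I_sq
  · linear_combination h0 - e2 - A 1 * s 1 * Complex.I_sq

theorem pauli_add (u v : Fin 3 → ℂ) : pauli u + pauli v = pauli (u + v) := by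
  ext a b
  fin_cases a <;> fin_cases b <;> simp [pauli] <;> ring

theorem pauli_smul (c : ℂ) (v : Fin 3 → ℂ) : c • pauli v = pauli (c • v) := by
  ext a b
  fin_cases a <;> fin_cases b <;> simp [pauli] <;> ring

theorem pauli_zero : pauli 0 = 0 := by
  ext a b
  fin_cases a <;> fin_cases b <;> simp [pauli]

theorem pauli_injective : Function.Injective pauli := fun u v h => by
  have h00 : u 2 = v 2 := congrFun (congrFun h 0) 0
  have h01 : u 0 - Complex.I * u 1 = v 0 - Complex.I * v 1 := congrFun (congrFun h 0) 1
  have h10 : u 0 + Complex.I * u 1 = v 0 + Complex.I * v 1 := congrFun (congrFun h 1) 0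
  ext i
  fin_cases i
  · simp only [Fin.zero_eta]
    linear_combination (h01 + h10) / 2
  · simp only [Fin.mk_one]
    linear_combination Complex.I * (h01 - h10) / 2 + (u 1 - v 1) * Complex.I_sq
  · exact h00

theorem pauli_sum {ι : Type*} (F : Finset ι) (v : ι → Fin 3 → ℂ) :
    ∑ k ∈ F, pauli (v k) = pauli (∑ k ∈ F, v k) :=
  (map_sum (⟨⟨pauli, pauli_zero⟩, fun u v => (pauli_add u v).symm⟩ : (Fin 3 → ℂ) →+ _) v F).symm

theorem pauli_conjTranspose (v : Fin 3 → ℂ) : (pauli v)ᴴ = pauli fun i => conj (v i) := by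
  ext a b
  fin_cases a <;> fin_cases b <;> simp [pauli, sub_eq_add_neg]

theorem pauli_mul_trace (u v : Fin 3 → ℂ) : (pauli u * pauli v).trace = 2 * (u ⬝ᵥ v) := by
  simp only [trace_fin_two, pauli, mul_apply, Fin.sum_univ_two, dotProduct, Fin.sum_univ_three]
  simp
  linear_combination -2 * u 1 * v 1 * Complex.I_sq

/-- The determinant of a Pauli matrix is -v · v, so null vectors give vanishing 2×2 minors. -/
theorem pauli_rank_one {v : Fin 3 → ℂ} (h : ∑ i, v i ^ 2 = 0) (a b c d : Fin 2) :
    pauli v a b * pauli v c d = pauli v a d * pauli v c b := by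
  simp only [Fin.sum_univ_three] at h
  have key : v 2 * -v 2 = (v 0 - Complex.I * v 1) * (v 0 + Complex.I * v 1) := by
    linear_combination -h + v 1 ^ 2 * Complex.I_sq
  fin_cases a <;> fin_cases b <;> fin_cases c <;> fin_cases d <;> simp [pauli] <;>
    first | ring1 | linear_combination key | linear_combination -key

theorem HasDerivAt.pauli {s : ℝ → Fin 3 → ℂ} {s' : Fin 3 → ℂ} {t : ℝ} (h : HasDerivAt s s' t) :
    HasMatDerivAt (fun τ => pauli (s τ)) (pauli s') t := by
  have hi := hasDerivAt_pi.1 h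
  intro a b
  fin_cases a <;> fin_cases b
  · exact hi 2
  · exact (hi 0).sub ((hi 1).const_mul _)
  · exact (hi 0).add ((hi 1).const_mul _)
  · exact (hi 2).neg

namespace IsRationalSolution

variable {N : ℕ} {m : ℝ → ℝ → Fin 3 → ℝ} {m₀ : Fin 3 → ℝ}
  {s : Fin N → ℝ → Fin 3 → ℂ} {p : Fin N → ℝ → ℂ}

/-- The spin equation is linear in s_j with coefficients continuous in time, so uniqueness for ODEs
applies. Spins are not assumed nonzero, and this makes vanishing a property of the index alone. -/
theorem spin_eq_zero (hm : IsRationalSolution m m₀ s p) {j : Fin N} {t₀ : ℝ} (h0 : s j t₀ = 0)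
    (t : ℝ) : s j t = 0 := by
  set Q : Fin 3 → ℝ → ℂ := fun i t => -2 * Complex.I *
    ∑ k, if k = j then 0 else s k t i / (p j t - p k t) ^ 2 with hQ
  have hQc : ∀ i, Continuous (Q i) := fun i => by
    refine continuous_const.mul (continuous_finsetSum _ fun k _ => ?_)
    split_ifs with hk
    · exact continuous_const
    · exact ((continuous_apply i).comp (hm.spin_differentiable k).continuous).div
        (((hm.pole_differentiable j).continuous.sub (hm.pole_differentiable k).continuous).pow 2)
        fun t => pow_ne_zero 2 (sub_ne_zero.2 ((hm.pole_injective t).ne (Ne.symm hk)))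
  obtain ⟨a, b, hat, hbt, hat₀, hbt₀⟩ : ∃ a b : ℝ, a < t ∧ t < b ∧ a < t₀ ∧ t₀ < b :=
    ⟨min t t₀ - 1, max t t₀ + 1, by linarith [min_le_left t t₀], by linarith [le_max_left t t₀],
      by linarith [min_le_right t t₀], by linarith [le_max_right t t₀]⟩
  obtain ⟨C, hC⟩ : ∃ C, ∀ τ ∈ Set.Icc a b, ∑ i, ‖Q i τ‖ ≤ C := by
    obtain ⟨C, hC⟩ := (isCompact_Icc (a := a) (b := b)).bddAbove_image
      (f := fun τ => ∑ i, ‖Q i τ‖) (by fun_prop)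
    exact ⟨C, fun τ hτ => hC ⟨τ, hτ, rfl⟩⟩
  have hC' : ∀ τ ∈ Set.Icc a b, ∀ i, ‖Q i τ‖ ≤ C := fun τ hτ i =>
    (Finset.single_le_sum (f := fun i => ‖Q i τ‖) (fun _ _ => norm_nonneg _)
      (Finset.mem_univ i)).trans (hC τ hτ)
  have hC0 : 0 ≤ C := (norm_nonneg _).trans (hC' t ⟨hat.le, hbt.le⟩ 0)
  set V : ℝ → (Fin 3 → ℂ) → Fin 3 → ℂ := fun τ y i =>
    y (i + 1) * Q (i + 2) τ - y (i + 2) * Q (i + 1) τ with hV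
  refine ODE_solution_unique_of_mem_Ioo (v := V) (s := fun _ => Set.univ)
    (K := (2 * C).toNNReal) (f := s j) (g := fun _ => 0) (t₀ := t₀) (a := a) (b := b)
    (fun τ hτ => ?_) ⟨hat₀, hbt₀⟩ (fun τ _ => ⟨?_, trivial⟩) (fun τ _ => ⟨?_, trivial⟩) h0
    (⟨hat, hbt⟩ : t ∈ Set.Ioo a b)
  · refine LipschitzOnWith.of_dist_le_mul fun y _ z _ => ?_
    rw [dist_eq_norm, dist_eq_norm, Real.coe_toNNReal _ (mul_nonneg zero_le_two hC0), pi_norm_le_iff_of_nonneg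
      (mul_nonneg (mul_nonneg zero_le_two hC0) (norm_nonneg _))]
    intro i
    have hτ' : τ ∈ Set.Icc a b := ⟨hτ.1.le, hτ.2.le⟩
    have e : (V τ y - V τ z) i = (y - z) (i + 1) * Q (i + 2) τ - (y - z) (i + 2) * Q (i + 1) τ := by
      simp only [hV, Pi.sub_apply]
      ring
    rw [e]
    refine (norm_sub_le _ _).trans ?_
    rw [norm_mul ((y - z) (i + 1)), norm_mul ((y - z) (i + 2))]
    have h1 := mul_le_mul (norm_le_pi_norm (y - z) (i + 1)) (hC' τ hτ' (i + 2)) (norm_nonneg _)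
      (norm_nonneg _)
    have h2 := mul_le_mul (norm_le_pi_norm (y - z) (i + 2)) (hC' τ hτ' (i + 1)) (norm_nonneg _)
      (norm_nonneg _)
    linarith
  · refine (hm.spin_differentiable j τ).hasDerivAt.congr_deriv ?_
    ext i
    rw [((hm.pole_equations j τ).2 i).2]
    simp only [hV, hQ]
    ring
  · refine (hasDerivAt_const τ (0 : Fin 3 → ℂ)).congr_deriv ?_
    ext i
    simp [hV]

theorem isSpinFlow (hm : IsRationalSolution m m₀ s p) (hs : ∀ j t, s j t ≠ 0) :
    IsSpinFlow (pauli fun i => m₀ i) (fun j t => pauli (s j t)) p where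
  hermitian := by simp [pauli_conjTranspose]
  differentiable := hm.pole_differentiable
  im_pos := hm.pole_im_pos
  injective := hm.pole_injective
  trace_eq_zero j t := by simp [trace_fin_two, pauli]
  rank_one j t a b c d := pauli_rank_one (hm.pole_equations j t).1.1 a b c d
  ne_zero j t h := hs j t (pauli_injective (h.trans pauli_zero.symm))
  spin j t := by
    have e : (∑ k, if k = j then 0 else ((p j t - p k t) ^ 2)⁻¹ • pauli (s k t)) =
        pauli fun i => ∑ k, if k = j then 0 else s k t i / (p j t - p k t) ^ 2 := by
      rw [Finset.sum_congr rfl fun k _ => show _ = pauli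
        (fun i => if k = j then 0 else s k t i / (p j t - p k t) ^ 2) by
          split_ifs
          · exact pauli_zero.symm
          · rw [pauli_smul]; congr 1; ext i; simp; ring, pauli_sum]
      congr 1
      ext i
      rw [Finset.sum_apply]
    rw [e, pauli_commutator]
    convert (hm.spin_differentiable j t).hasDerivAt.pauli using 2
    ext i
    rw [((hm.pole_equations j t).2 i).2]
  pole j t := by
    have e1 : (∑ k, if k = j then 0 else (p j t - p k t)⁻¹ • pauli (s k t)) =
        pauli fun i => ∑ k, if k = j then 0 else s k t i / (p j t - p k t) := by
      rw [Finset.sum_congr rfl fun k _ => show _ = pauli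
        (fun i => if k = j then 0 else s k t i / (p j t - p k t)) by
          split_ifs
          · exact pauli_zero.symm
          · rw [pauli_smul]; congr 1; ext i; simp; ring, pauli_sum]
      congr 1
      ext i
      rw [Finset.sum_apply]
    have e2 : (∑ k, (p j t - conj (p k t))⁻¹ • (pauli (s k t))ᴴ) =
        pauli fun i => ∑ k, conj (s k t i) / (p j t - conj (p k t)) := by
      rw [Finset.sum_congr rfl fun k _ => show _ = pauli
        (fun i => conj (s k t i) / (p j t - conj (p k t))) by
          rw [pauli_conjTranspose, pauli_smul]; congr 1; ext i; simp; ring, pauli_sum]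
      congr 1
      ext i
      rw [Finset.sum_apply]
    rw [e1, e2, pauli_add, pauli_add]
    exact pauli_mul_of_cross (hm.pole_equations j t).1.2 fun i => ((hm.pole_equations j t).2 i).1

end IsRationalSolution

/-! ### Limits of poles. -/

-- Poles are given in homogeneous coordinates β/α, so a may vanish and a pole may go to infinity.
-- Clearing denominators gives polynomials P n of bounded degree that converge on the lower half
-- plane, hence everywhere. The limit identity, evaluated at y k, leaves q(y k)² times a nonzero
-- number equal to zero.
open Polynomial in
theorem limit_factor_eq_zero {ι κ : Type*} [DecidableEq ι] [DecidableEq κ]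
    {J : Finset ι} {K : Finset κ} {σ α β : ℕ → ι → ℂ} {a b : ι → ℂ} {c y : κ → ℂ}
    (ha : ∀ j ∈ J, Tendsto (fun n => α n j) atTop (𝓝 (a j)))
    (hb : ∀ j ∈ J, Tendsto (fun n => β n j) atTop (𝓝 (b j)))
    (hαβ : ∀ n, ∀ j ∈ J, ∀ ζ : ℂ, ζ.im < 0 → α n j * ζ - β n j ≠ 0)
    (hy : Set.InjOn y K) (hy_im : ∀ k ∈ K, 0 < (y k).im)
    (hlim : ∀ ζ : ℂ, ζ.im < 0 → Tendsto (fun n => ∑ j ∈ J, σ n j / (α n j * ζ - β n j) ^ 2) atTop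
      (𝓝 (∑ k ∈ K, c k / (ζ - y k) ^ 2)))
    {k : κ} (hk : k ∈ K) (hc : c k ≠ 0) : ∃ j ∈ J, a j * y k = b j := by
  set q : ℂ[X] := ∏ j ∈ J, (C (a j) * X - C (b j)) with hq
  suffices h : q.eval (y k) = 0 by
    rw [hq, eval_prod, Finset.prod_eq_zero_iff] at h
    obtain ⟨j, hj, h⟩ := h
    exact ⟨j, hj, by simpa [sub_eq_zero] using h⟩
  set P : ℕ → ℂ[X] := fun n =>
    ∑ j ∈ J, C (σ n j) * ∏ l ∈ J.erase j, (C (α n l) * X - C (β n l)) ^ 2 with hP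
  have hdeg : ∀ n, (P n).degree < (Finset.range (2 * J.card + 1)).card := fun n => by
    rw [Finset.card_range]
    refine lt_of_le_of_lt (b := ((2 * J.card : ℕ) : WithBot ℕ)) ?_ (by exact_mod_cast Nat.lt_succ_self _)
    refine (degree_sum_le _ _).trans (Finset.sup_le fun j _ => ?_)
    refine (degree_le_natDegree).trans ?_
    norm_cast
    refine (natDegree_C_mul_le _ _).trans ((natDegree_prod_le _ _).trans ?_)
    refine (Finset.sum_le_card_nsmul _ _ 2 fun l _ => ?_).trans ?_
    · refine natDegree_pow_le.trans ?_
      have : (C (α n l) * X - C (β n l)).natDegree ≤ 1 := by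
        rw [natDegree_sub_C]
        exact (natDegree_C_mul_le _ _).trans natDegree_X_le
      omega
    · have := Finset.card_erase_le (s := J) (a := j)
      simp only [smul_eq_mul]
      omega
  have hPeval : ∀ n, ∀ ζ : ℂ, ζ.im < 0 → (P n).eval ζ =
      (∏ j ∈ J, (α n j * ζ - β n j)) ^ 2 * ∑ j ∈ J, σ n j / (α n j * ζ - β n j) ^ 2 := by
    intro n ζ hζ
    simp only [hP, eval_finsetSum, eval_mul, eval_C, eval_prod, eval_pow, eval_sub, eval_X,
      Finset.mul_sum]
    refine Finset.sum_congr rfl fun j hj => ?_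
    rw [← Finset.mul_prod_erase J _ hj, mul_pow, Finset.prod_pow]
    have := hαβ n j hj ζ hζ
    generalize α n j * ζ - β n j = A at this ⊢
    field_simp
    simp only [mul_comm ζ]
  have hPlim : ∀ ζ : ℂ, ζ.im < 0 → Tendsto (fun n => (P n).eval ζ) atTop
      (𝓝 (q.eval ζ ^ 2 * ∑ k ∈ K, c k / (ζ - y k) ^ 2)) := fun ζ hζ => by
    simp only [hPeval _ ζ hζ]
    refine Tendsto.mul (Tendsto.pow ?_ 2) (hlim ζ hζ)
    simp only [hq, eval_prod, eval_sub, eval_mul, eval_C, eval_X]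
    exact tendsto_finsetProd _ fun j hj => ((ha j hj).mul_const ζ).sub (hb j hj)
  -- Interpolation at enough nodes in the lower half plane reduces convergence of P n at an
  -- arbitrary point to convergence at the nodes.
  set ν : ℕ → ℂ := fun r => -Complex.I * (r + 1) with hν
  have hν_im : ∀ r, (ν r).im < 0 := fun r => by
    have : (0 : ℝ) ≤ r := r.cast_nonneg
    simp [hν]
    linarith
  have hν_inj : Function.Injective ν := fun r r' h => by
    simpa [hν] using h
  set I := Finset.range (2 * J.card + 1)
  set Q : ℂ[X] := Lagrange.interpolate I ν fun r =>
    q.eval (ν r) ^ 2 * ∑ k ∈ K, c k / (ν r - y k) ^ 2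
  have hQlim : ∀ w : ℂ, Tendsto (fun n => (P n).eval w) atTop (𝓝 (Q.eval w)) := fun w => by
    have e : ∀ n, P n = Lagrange.interpolate I ν fun r => (P n).eval (ν r) := fun n =>
      Lagrange.eq_interpolate_of_eval_eq _ hν_inj.injOn (hdeg n) fun r _ => rfl
    have e' : ∀ n, (P n).eval w = ∑ r ∈ I, (P n).eval (ν r) * (Lagrange.basis I ν r).eval w :=
      fun n => by
        conv_lhs => rw [e n]
        simp [Lagrange.interpolate_apply, eval_finsetSum]
    simp only [e']
    simp only [Q, Lagrange.interpolate_apply, eval_finsetSum, eval_mul, eval_C]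
    exact tendsto_finsetSum _ fun r _ => (hPlim _ (hν_im r)).mul_const _
  have hQ : ∀ ζ : ℂ, ζ.im < 0 → Q.eval ζ = q.eval ζ ^ 2 * ∑ k ∈ K, c k / (ζ - y k) ^ 2 :=
    fun ζ hζ => tendsto_nhds_unique (hQlim ζ) (hPlim ζ hζ)
  have hpoly : Q * ∏ k ∈ K, (X - C (y k)) ^ 2 =
      q ^ 2 * ∑ k ∈ K, C (c k) * ∏ l ∈ K.erase k, (X - C (y l)) ^ 2 := by
    refine eq_of_infinite_eval_eq _ _ ((Set.infinite_range_of_injective hν_inj).mono ?_)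
    rintro _ ⟨r, rfl⟩
    simp only [Set.mem_ofPred_eq, eval_mul, eval_finsetSum, eval_C, eval_prod, eval_pow, eval_sub,
      eval_X]
    rw [hQ _ (hν_im r), mul_assoc, Finset.sum_mul]
    congr 1
    refine Finset.sum_congr rfl fun l hl => ?_
    rw [← Finset.mul_prod_erase K _ hl]
    have : ν r - y l ≠ 0 := fun h => by
      have h1 := congrArg Complex.im h
      have h2 := hν_im r
      have h3 := hy_im l hl
      simp only [Complex.sub_im, Complex.zero_im] at h1
      linarith
    field_simp
  have hev := congrArg (eval (y k)) hpoly
  simp only [eval_mul, eval_finsetSum, eval_C, eval_prod, eval_pow, eval_sub, eval_X] at hev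
  rw [Finset.prod_eq_zero hk (by simp), mul_zero, Finset.sum_eq_single k
    (fun l _ hlk => by
      rw [Finset.prod_eq_zero (Finset.mem_erase.2 ⟨hlk.symm, hk⟩) (by simp), mul_zero])
    (fun h => (h hk).elim)] at hev
  have hprod : ∏ l ∈ K.erase k, (y k - y l) ^ 2 ≠ 0 := by
    refine Finset.prod_ne_zero_iff.2 fun l hl => pow_ne_zero 2 (sub_ne_zero.2 fun h => ?_)
    exact (Finset.mem_erase.1 hl).1 (hy hk (Finset.mem_erase.1 hl).2 h).symm
  have := (mul_eq_zero.1 hev.symm).resolve_right (mul_ne_zero hc hprod)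
  exact pow_eq_zero_iff two_ne_zero |>.1 this

/-- By compactness the poles converge in the projective line along a subsequence, and each y k is a
limit of a pole with index in J. Distinct y k need distinct indices, so this assignment is a
bijection of `Fin N`: J is everything and every limit is finite. -/
theorem poles_bounded_of_tendsto {N : ℕ} {y : Fin N → ℂ} (hy : Function.Injective y)
    (hy_im : ∀ k, 0 < (y k).im) {c : Fin N → Fin 3 → ℂ} (hc : ∀ k, c k ≠ 0) (J : Finset (Fin N))
    {z : ℕ → Fin N → ℂ} {s : ℕ → Fin N → Fin 3 → ℂ} (hz : ∀ n j, 0 < (z n j).im)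
    (hlim : ∀ ζ : ℂ, ζ.im < 0 → ∀ i, Tendsto (fun n => ∑ j, s n j i / (ζ - z n j) ^ 2) atTop
      (𝓝 (∑ k, c k i / (ζ - y k) ^ 2)))
    (hJ : ∀ n, ∀ j ∉ J, s n j = 0) :
    J = Finset.univ ∧ ∃ φ : ℕ → ℕ, StrictMono φ ∧ ∃ R, ∀ n j, ‖z (φ n) j‖ ≤ R := by
  -- Homogeneous coordinates (α, αz) of the pole z with |α| + |αz| = 1; the limit cannot be (0, 0).
  set f : ℕ → Fin N → ℂ × ℂ := fun n j =>
    (((1 + ‖z n j‖ : ℝ) : ℂ)⁻¹, ((1 + ‖z n j‖ : ℝ) : ℂ)⁻¹ * z n j) with hf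
  have hpos : ∀ n j, 0 < 1 + ‖z n j‖ := fun n j => by positivity
  have hne : ∀ n j, ((1 + ‖z n j‖ : ℝ) : ℂ) ≠ 0 := fun n j => by exact_mod_cast (hpos n j).ne'
  have hnorm1 : ∀ n j, ‖(f n j).1‖ = (1 + ‖z n j‖)⁻¹ := fun n j => by
    simp only [hf, norm_inv, Complex.norm_real, Real.norm_eq_abs, abs_of_pos (hpos n j)]
  have hnorm2 : ∀ n j, ‖(f n j).2‖ = (1 + ‖z n j‖)⁻¹ * ‖z n j‖ := fun n j => by
    simp only [hf, norm_mul, norm_inv, Complex.norm_real, Real.norm_eq_abs, abs_of_pos (hpos n j)]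
  have hsum : ∀ n j, ‖(f n j).1‖ + ‖(f n j).2‖ = 1 := fun n j => by
    rw [hnorm1, hnorm2]
    have := (hpos n j).ne'
    field_simp
  obtain ⟨g, -, φ, hφ, hg⟩ := tendsto_subseq_of_bounded (Metric.isBounded_closedBall (x := 0) (r := 1))
    (x := f) (fun n => by
      rw [mem_closedBall_zero_iff, pi_norm_le_iff_of_nonneg zero_le_one]
      intro j
      rw [Prod.norm_def, max_le_iff]
      constructor <;> linarith [hsum n j, norm_nonneg (f n j).1, norm_nonneg (f n j).2])
  have hgj := tendsto_pi_nhds.1 hg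
  have hg1 : ∀ j, Tendsto (fun n => (f (φ n) j).1) atTop (𝓝 (g j).1) := fun j =>
    (continuous_fst.tendsto _).comp (hgj j)
  have hg2 : ∀ j, Tendsto (fun n => (f (φ n) j).2) atTop (𝓝 (g j).2) := fun j =>
    (continuous_snd.tendsto _).comp (hgj j)
  have hgsum : ∀ j, ‖(g j).1‖ + ‖(g j).2‖ = 1 := fun j =>
    tendsto_nhds_unique ((hg1 j).norm.add (hg2 j).norm) (by simp [hsum])
  have hex : ∀ k, ∃ j ∈ J, (g j).1 * y k = (g j).2 := fun k => by
    obtain ⟨i, hi⟩ : ∃ i, c k i ≠ 0 := by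
      by_contra! h
      exact hc k (funext h)
    have hfz : ∀ n j (ζ : ℂ), (f n j).1 * ζ - (f n j).2 = (f n j).1 * (ζ - z n j) := fun n j ζ => by
      simp only [hf]; ring
    have hf0 : ∀ n j, (f n j).1 ≠ 0 := fun n j => inv_ne_zero (hne n j)
    have hζz : ∀ n j (ζ : ℂ), ζ.im < 0 → ζ - z n j ≠ 0 := fun n j ζ hζ h => by
      have h1 := congrArg Complex.im h
      simp only [Complex.sub_im, Complex.zero_im] at h1
      linarith [hz n j]
    refine limit_factor_eq_zero (J := J) (K := Finset.univ)
      (σ := fun n j => s (φ n) j i * (f (φ n) j).1 ^ 2)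
      (c := fun k => c k i) (fun j _ => hg1 j) (fun j _ => hg2 j) (fun n j _ ζ hζ => ?_)
      hy.injOn (fun k _ => hy_im k) (fun ζ hζ => ?_) (Finset.mem_univ k) hi
    · rw [hfz]
      exact mul_ne_zero (hf0 _ _) (hζz _ _ ζ hζ)
    · refine ((hlim ζ hζ i).comp hφ.tendsto_atTop).congr fun n => ?_
      rw [Function.comp, ← Finset.sum_subset (Finset.subset_univ J)
        (fun j _ hj => by simp [hJ _ j hj])]
      refine Finset.sum_congr rfl fun j _ => ?_
      rw [hfz]
      have h1 := hf0 (φ n) j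
      have h2 := hζz (φ n) j ζ hζ
      field_simp
  choose τ hτJ hτ using hex
  have hg0 : ∀ k, (g (τ k)).1 ≠ 0 := fun k h => by
    have h1 := hτ k
    have h2 := hgsum (τ k)
    rw [h, zero_mul] at h1
    rw [h, ← h1] at h2
    simp at h2
  have hτinj : Function.Injective τ := fun k k' h => by
    have h1 := hτ k
    have h2 := hτ k'
    rw [← h, ← h1] at h2
    exact hy (mul_left_cancel₀ (hg0 k) h2.symm)
  have hτsurj : Function.Surjective τ := Finite.surjective_of_injective hτinj
  refine ⟨Finset.eq_univ_of_forall fun j => ?_, φ, hφ, ?_⟩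
  · obtain ⟨k, rfl⟩ := hτsurj j
    exact hτJ k
  · have hzlim : Tendsto (fun n => z (φ n)) atTop (𝓝 fun j => (g j).2 / (g j).1) := by
      refine tendsto_pi_nhds.2 fun j => ?_
      obtain ⟨k, rfl⟩ := hτsurj j
      refine ((hg2 _).div (hg1 _) (hg0 k)).congr fun n => ?_
      have := hne (φ n) (τ k)
      simp only [hf, Pi.div_apply]
      field_simp
    obtain ⟨R, hR⟩ := (Metric.isBounded_range_of_tendsto _ hzlim).exists_norm_le
    exact ⟨R, fun n j => (norm_le_pi_norm _ j).trans (hR _ ⟨n, rfl⟩)⟩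

/-! ### Fourier transforms of simple poles and the half-derivative norm. -/

theorem integral_fourierInv_mul {φ g : ℝ → ℂ} (hφ : Integrable φ) (hg : Integrable g) :
    ∫ ξ, 𝓕⁻ φ ξ • g ξ = ∫ x, φ x • 𝓕⁻ g x := by
  have hc : Continuous fun p : ℝ × ℝ => (-innerₗ ℝ) p.1 p.2 := by
    simp only [LinearMap.neg_apply, innerₗ_apply_apply]
    fun_prop
  have hflip : (-innerₗ ℝ : ℝ →ₗ[ℝ] ℝ →ₗ[ℝ] ℝ).flip = -innerₗ ℝ := by
    ext; simp
  have := VectorFourier.integral_fourierIntegral_smul_eq_flip (μ := volume) (ν := volume)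
    (L := -innerₗ ℝ) Real.continuous_fourierChar hc hφ hg
  rw [hflip] at this
  exact this

/-- The L² transform agrees with the integral formula for g in L¹ ∩ L²: both sides define the same
tempered distribution, by moving the inverse transform onto the Schwartz function. -/
theorem fourier_toLp_ae_eq {D g : ℝ → ℂ} (hD : MemLp D 2) (hg1 : Integrable g)
    (hg2 : MemLp g 2) (h : ∀ x, D x = 𝓕⁻ g x) :
    (𝓕 (hD.toLp D) : Lp ℂ 2 (volume : Measure ℝ)) =ᵐ[volume] g := by
  have key : 𝓕⁻ (hg2.toLp g) = hD.toLp D := by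
    refine LinearMap.ker_eq_bot.1
      (Lp.ker_toTemperedDistributionCLM_eq_bot (F := ℂ) (μ := (volume : Measure ℝ)) (p := 2)) ?_
    change ((𝓕⁻ (hg2.toLp g) : Lp ℂ 2 (volume : Measure ℝ)) : TemperedDistribution ℝ ℂ) =
      ((hD.toLp D : Lp ℂ 2 (volume : Measure ℝ)) : TemperedDistribution ℝ ℂ)
    rw [← Lp.fourierInv_toTemperedDistribution_eq]
    ext φ
    rw [TemperedDistribution.fourierInv_apply, Lp.toTemperedDistribution_apply,
      Lp.toTemperedDistribution_apply]
    calc _ = ∫ x, (𝓕⁻ (φ : ℝ → ℂ)) x • g x := by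
          refine integral_congr_ae ?_
          filter_upwards [hg2.coeFn_toLp] with x hx
          rw [hx, SchwartzMap.fourierInv_coe]
      _ = ∫ x, φ x • 𝓕⁻ g x := integral_fourierInv_mul φ.integrable hg1
      _ = _ := by
          refine integral_congr_ae ?_
          filter_upwards [hD.coeFn_toLp] with x hx
          rw [hx, h]
  rw [← key, FourierTransform.fourier_fourierInv_eq]
  exact hg2.coeFn_toLp

/-- `g` is an integrable and square integrable function with inverse Fourier transform `D ∈ L²`. -/
structure IsFourierPair (D g : ℝ → ℂ) : Prop where
  memLp : MemLp D 2
  integrable : Integrable g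
  memLp' : MemLp g 2
  eq : ∀ x, D x = 𝓕⁻ g x

namespace IsFourierPair

theorem add {D₁ D₂ g₁ g₂ : ℝ → ℂ} (h₁ : IsFourierPair D₁ g₁) (h₂ : IsFourierPair D₂ g₂) :
    IsFourierPair (fun x => D₁ x + D₂ x) (fun η => g₁ η + g₂ η) where
  memLp := h₁.memLp.add h₂.memLp
  integrable := h₁.integrable.add h₂.integrable
  memLp' := h₁.memLp'.add h₂.memLp'
  eq x := by
    have hc : Continuous fun p : ℝ × ℝ => (-innerₗ ℝ) p.1 p.2 := by
      simp only [LinearMap.neg_apply, innerₗ_apply_apply]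
      fun_prop
    rw [h₁.eq, h₂.eq]
    exact (congrFun (VectorFourier.fourierIntegral_add Real.continuous_fourierChar hc
      h₁.integrable h₂.integrable) x).symm

theorem const_mul {D g : ℝ → ℂ} (h : IsFourierPair D g) (c : ℂ) :
    IsFourierPair (fun x => c * D x) (fun η => c * g η) where
  memLp := h.memLp.const_mul c
  integrable := h.integrable.const_mul c
  memLp' := h.memLp'.const_mul c
  eq x := by
    rw [h.eq, Real.fourierInv_eq, Real.fourierInv_eq, ← integral_const_mul]
    refine integral_congr_ae (Eventually.of_forall fun η => ?_)
    simp only [Circle.smul_def, smul_eq_mul]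
    ring

theorem sum {ι : Type*} (F : Finset ι) {D g : ι → ℝ → ℂ} (h : ∀ k, IsFourierPair (D k) (g k)) :
    IsFourierPair (fun x => ∑ k ∈ F, D k x) (fun η => ∑ k ∈ F, g k η) := by
  classical
  induction F using Finset.induction_on with
  | empty =>
    simp only [Finset.sum_empty]
    refine ⟨MemLp.zero', integrable_zero _ _ _, MemLp.zero', fun x => ?_⟩
    rw [Real.fourierInv_eq]
    simp
  | insert k F hk ih =>
    simp only [Finset.sum_insert hk]
    exact (h k).add ih

theorem hDotHalfSq_eq {D g : ℝ → ℂ} (h : IsFourierPair D g) :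
    hDotHalfSq D = ENNReal.ofReal (2 * Real.pi) * ∫⁻ η, ‖g η‖ₑ ^ 2 * ENNReal.ofReal |η| := by
  rw [hDotHalfSq, dif_pos h.memLp]
  congr 1
  refine lintegral_congr_ae ?_
  filter_upwards [fourier_toLp_ae_eq h.memLp h.integrable h.memLp' h.eq] with η hη
  rw [hη]

end IsFourierPair

/-- The Fourier transform of `x ↦ (x - a)⁻¹` for `a` in the upper half plane. -/
noncomputable def poleFourier (a : ℂ) : ℝ → ℂ :=
  (Set.Iic 0).indicator fun η => 2 * Real.pi * Complex.I * Complex.exp (-(2 * Real.pi * Complex.I * a) * η)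

/-- The Fourier transform of `x ↦ (x - conj a)⁻¹` for `a` in the upper half plane. -/
noncomputable def poleFourierConj (a : ℂ) : ℝ → ℂ :=
  (Set.Ioi 0).indicator fun η =>
    -(2 * Real.pi * Complex.I) * Complex.exp (-(2 * Real.pi * Complex.I * conj a) * η)

theorem memLp_inv_sub {a : ℂ} (ha : a.im ≠ 0) : MemLp (fun x : ℝ => ((x : ℂ) - a)⁻¹) 2 := by
  rw [memLp_two_iff_integrable_sq_norm (by fun_prop)]
  simpa using integrable_inv_normSq_sub ha

theorem isFourierPair_pole {a : ℂ} (ha : 0 < a.im) :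
    IsFourierPair (fun x : ℝ => ((x : ℂ) - a)⁻¹) (poleFourier a) where
  memLp := memLp_inv_sub ha.ne'
  integrable := by
    refine IntegrableOn.integrable_indicator ?_ measurableSet_Iic
    exact (integrableOn_exp_mul_complex_Iic (by simp; positivity) 0).const_mul _
  memLp' := by
    rw [poleFourier, memLp_indicator_iff_restrict measurableSet_Iic,
      memLp_two_iff_integrable_sq_norm (by fun_prop)]
    refine ((integrableOn_exp_mul_complex_Iic (a := 2 * (-(2 * Real.pi * Complex.I * a)))
      (by simp; positivity) 0).norm.const_mul ((2 * Real.pi) ^ 2)).congr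
      (Eventually.of_forall fun η => ?_)
    simp only [norm_mul, mul_pow, Complex.norm_exp, ← Real.exp_nat_mul]
    simp
    ring
  eq x := by
    have e : ∀ η : ℝ, Complex.exp (↑(2 * Real.pi * inner ℝ η x) * Complex.I) • poleFourier a η =
        (Set.Iic (0 : ℝ)).indicator (fun η : ℝ => 2 * Real.pi * Complex.I *
          Complex.exp (2 * Real.pi * Complex.I * (x - a) * η)) η := fun η => by
      by_cases hη : η ∈ Set.Iic (0 : ℝ)
      · rw [poleFourier, Set.indicator_of_mem hη, Set.indicator_of_mem hη, smul_eq_mul,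
          mul_left_comm, ← Complex.exp_add]
        congr 2
        simp
        ring
      · rw [poleFourier, Set.indicator_of_notMem hη, Set.indicator_of_notMem hη, smul_zero]
    rw [Real.fourierInv_eq']
    simp_rw [e]
    rw [integral_indicator measurableSet_Iic, integral_const_mul,
      integral_exp_mul_complex_Iic (by simp; positivity)]
    have h1 := ofReal_sub_ne_zero ha.ne' x
    have h2 : (Real.pi : ℂ) ≠ 0 := by exact_mod_cast Real.pi_ne_zero
    field_simp
    simp

theorem isFourierPair_pole_conj {a : ℂ} (ha : 0 < a.im) :
    IsFourierPair (fun x : ℝ => ((x : ℂ) - conj a)⁻¹) (poleFourierConj a) where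
  memLp := memLp_inv_sub (by simpa using ha.ne')
  integrable := by
    refine IntegrableOn.integrable_indicator ?_ measurableSet_Ioi
    exact (integrableOn_exp_mul_complex_Ioi (by simp; positivity) 0).const_mul _
  memLp' := by
    rw [poleFourierConj, memLp_indicator_iff_restrict measurableSet_Ioi,
      memLp_two_iff_integrable_sq_norm (by fun_prop)]
    refine ((integrableOn_exp_mul_complex_Ioi (a := 2 * (-(2 * Real.pi * Complex.I * conj a)))
      (by simp; positivity) 0).norm.const_mul ((2 * Real.pi) ^ 2)).congr
      (Eventually.of_forall fun η => ?_)
    simp only [norm_mul, mul_pow, Complex.norm_exp, ← Real.exp_nat_mul]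
    simp
    rw [mul_pow, sq_abs]
    ring_nf
  eq x := by
    have e : ∀ η : ℝ, Complex.exp (↑(2 * Real.pi * inner ℝ η x) * Complex.I) • poleFourierConj a η =
        (Set.Ioi (0 : ℝ)).indicator (fun η : ℝ => -(2 * Real.pi * Complex.I) *
          Complex.exp (2 * Real.pi * Complex.I * (x - conj a) * η)) η := fun η => by
      by_cases hη : η ∈ Set.Ioi (0 : ℝ)
      · rw [poleFourierConj, Set.indicator_of_mem hη, Set.indicator_of_mem hη, smul_eq_mul,
          mul_left_comm, ← Complex.exp_add]
        congr 2
        simp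
        ring
      · rw [poleFourierConj, Set.indicator_of_notMem hη, Set.indicator_of_notMem hη, smul_zero]
    rw [Real.fourierInv_eq']
    simp_rw [e]
    rw [integral_indicator measurableSet_Ioi, integral_const_mul,
      integral_exp_mul_complex_Ioi (by simp; positivity)]
    have h1 := ofReal_sub_ne_zero (a := conj a) (by simpa using ha.ne') x
    have h2 : (Real.pi : ℂ) ≠ 0 := by exact_mod_cast Real.pi_ne_zero
    field_simp
    simp

theorem integrableOn_mul_exp {b : ℝ} (hb : b < 0) :
    IntegrableOn (fun r : ℝ => r * Real.exp (b * r)) (Set.Ioi 0) := by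
  simpa using integrableOn_rpow_mul_exp_neg_mul_rpow (s := 1) (p := 1) (b := -b)
    (by norm_num) one_pos (by linarith)

theorem integrableOn_mul_cexp {b : ℂ} (hb : 0 < b.re) :
    IntegrableOn (fun r : ℝ => (r : ℂ) * Complex.exp (-(b * r))) (Set.Ioi 0) := by
  refine (integrableOn_mul_exp (neg_neg_of_pos hb)).mono' (by fun_prop) ?_
  filter_upwards [ae_restrict_mem measurableSet_Ioi] with r hr
  rw [norm_mul, Complex.norm_exp, Complex.norm_real, Real.norm_of_nonneg (le_of_lt hr)]
  simp

theorem integral_mul_cexp {b : ℂ} (hb : 0 < b.re) :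
    ∫ r : ℝ in Set.Ioi 0, (r : ℂ) * Complex.exp (-(b * r)) = (b ^ 2)⁻¹ := by
  have hb0 : b ≠ 0 := fun h => by simp [h] at hb
  have hd : ∀ r : ℝ, HasDerivAt (fun r : ℝ => -((r : ℂ) * b⁻¹ + (b ^ 2)⁻¹) * Complex.exp (-(b * r)))
      ((r : ℂ) * Complex.exp (-(b * r))) r := fun r => by
    have h1 := (hasDerivAt_id r).ofReal_comp
    have h2 := ((h1.mul_const b⁻¹).add_const (b ^ 2)⁻¹).neg.mul ((h1.const_mul b).neg.cexp)
    refine h2.congr_deriv ?_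
    simp only [id_eq, Pi.neg_apply]
    field_simp
    push_cast
    ring
  have hexp : IntegrableOn (fun r : ℝ => Complex.exp (-(b * r))) (Set.Ioi 0) := by
    simpa using integrableOn_exp_mul_complex_Ioi (a := -b) (by simpa using hb) 0
  have hF : IntegrableOn
      (fun r : ℝ => -((r : ℂ) * b⁻¹ + (b ^ 2)⁻¹) * Complex.exp (-(b * r))) (Set.Ioi 0) := by
    refine (((integrableOn_mul_cexp hb).const_mul (-b⁻¹)).add
      (hexp.const_mul (-(b ^ 2)⁻¹))).congr (Eventually.of_forall fun r => ?_)
    simp only [Pi.add_apply]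
    ring
  have h := integral_Ioi_of_hasDerivAt_of_tendsto' (a := 0) (fun r _ => hd r)
    (integrableOn_mul_cexp hb)
    (tendsto_zero_of_hasDerivAt_of_integrableOn_Ioi (fun r _ => hd r) (integrableOn_mul_cexp hb) hF)
  simpa using h

/-- The constant in the bound for `∑ₖ σₖ / (ζ - aₖ)²` by the `Ḣ^{1/2}` norm, for `Im ζ = δ`. -/
noncomputable def halfPlaneWeight (δ : ℝ) : ℝ≥0∞ :=
  ENNReal.ofReal (2 * Real.pi) *
    (∫⁻ r : ℝ in Set.Ioi 0, ENNReal.ofReal (r * Real.exp (4 * Real.pi * δ * r))) ^ (1 / 2 : ℝ)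

theorem halfPlaneWeight_ne_top {δ : ℝ} (hδ : δ < 0) : halfPlaneWeight δ ≠ ⊤ := by
  refine ENNReal.mul_ne_top ENNReal.ofReal_ne_top (ENNReal.rpow_ne_top_of_nonneg (by norm_num) ?_)
  refine ((integrableOn_mul_exp ?_).lintegral_lt_top).ne
  nlinarith [Real.pi_pos]

/-- The Fourier transform of `x ↦ ∑ₖ σₖ / (x - aₖ) + ∑ₖ conj σₖ / (x - conj aₖ)`. -/
noncomputable def rationalFourier {ι : Type*} [Fintype ι] (σ a : ι → ℂ) (η : ℝ) : ℂ :=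
  ∑ k, σ k * poleFourier (a k) η + ∑ k, conj (σ k) * poleFourierConj (a k) η

theorem isFourierPair_rational {ι : Type*} [Fintype ι] {σ a : ι → ℂ} (ha : ∀ k, 0 < (a k).im) :
    IsFourierPair (fun x : ℝ => ∑ k, σ k * ((x : ℂ) - a k)⁻¹ +
      ∑ k, conj (σ k) * ((x : ℂ) - conj (a k))⁻¹) (rationalFourier σ a) :=
  (IsFourierPair.sum _ fun k => (isFourierPair_pole (ha k)).const_mul (σ k)).add
    (IsFourierPair.sum _ fun k => (isFourierPair_pole_conj (ha k)).const_mul (conj (σ k)))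

/-- Negative frequencies see only the poles in the upper half plane, and r exp(-br) integrates to
b⁻² over r > 0. -/
theorem sum_div_sq_eq_integral {ι : Type*} [Fintype ι] {σ a : ι → ℂ} (ha : ∀ k, 0 < (a k).im)
    {ζ : ℂ} (hζ : ζ.im < 0) :
    ∑ k, σ k / (ζ - a k) ^ 2 = 2 * Real.pi * Complex.I * ∫ r : ℝ in Set.Ioi 0,
      r * Complex.exp (-(2 * Real.pi * Complex.I * ζ * r)) * rationalFourier σ a (-r) := by
  have hb : ∀ k, 0 < (2 * Real.pi * Complex.I * (ζ - a k)).re := fun k => by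
    have : (2 * Real.pi * Complex.I * (ζ - a k)).re = 2 * Real.pi * ((a k).im - ζ.im) := by
      simp; ring
    rw [this]
    have := ha k
    have := Real.pi_pos
    apply mul_pos <;> linarith
  have e : ∫ r : ℝ in Set.Ioi 0,
      r * Complex.exp (-(2 * Real.pi * Complex.I * ζ * r)) * rationalFourier σ a (-r) =
      ∫ r : ℝ in Set.Ioi 0, ∑ k, (2 * Real.pi * Complex.I * σ k) *
        ((r : ℂ) * Complex.exp (-(2 * Real.pi * Complex.I * (ζ - a k) * r))) := by
    refine setIntegral_congr_fun measurableSet_Ioi fun r hr => ?_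
    have hr' : 0 < r := hr
    have h1 : ∀ k, poleFourier (a k) (-r) =
        2 * Real.pi * Complex.I * Complex.exp (2 * Real.pi * Complex.I * a k * r) := fun k => by
      rw [poleFourier, Set.indicator_of_mem (by simpa using hr'.le)]
      simp
    have h2 : ∀ k, poleFourierConj (a k) (-r) = 0 := fun k => by
      rw [poleFourierConj, Set.indicator_of_notMem (by simpa using hr'.le)]
    simp only [rationalFourier, h1, h2, mul_zero, Finset.sum_const_zero, add_zero,
      Finset.mul_sum]
    refine Finset.sum_congr rfl fun k _ => ?_
    have h3 : -(2 * Real.pi * Complex.I * (ζ - a k) * r) =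
      -(2 * Real.pi * Complex.I * ζ * r) + 2 * Real.pi * Complex.I * a k * r := by ring
    rw [h3, Complex.exp_add]
    ring
  rw [e, integral_finsetSum _ fun k _ => (integrableOn_mul_cexp (hb k)).const_mul _,
    Finset.mul_sum]
  refine Finset.sum_congr rfl fun k _ => ?_
  rw [integral_const_mul, integral_mul_cexp (hb k)]
  have h1 : (Real.pi : ℂ) ≠ 0 := by exact_mod_cast Real.pi_ne_zero
  have h2 : ζ - a k ≠ 0 := fun h => by
    have := congrArg Complex.im h
    have := ha k
    simp at *
    linarith
  field_simp

/-- Cauchy–Schwarz in the integral formula, with r split as √r · √r: one root goes with the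
exponential into the weight, the other with the Fourier transform into the Ḣ^{1/2} norm. -/
theorem enorm_sum_div_sq_le {ι : Type*} [Fintype ι] {σ a : ι → ℂ} (ha : ∀ k, 0 < (a k).im)
    {ζ : ℂ} (hζ : ζ.im < 0) {D : ℝ → ℂ}
    (hD : ∀ x, D x = ∑ k, σ k * ((x : ℂ) - a k)⁻¹ + ∑ k, conj (σ k) * ((x : ℂ) - conj (a k))⁻¹) :
    ‖∑ k, σ k / (ζ - a k) ^ 2‖ₑ ≤ halfPlaneWeight ζ.im * hDotHalfSq D ^ (1 / 2 : ℝ) := by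
  have hpair := isFourierPair_rational (σ := σ) ha
  rw [← funext hD] at hpair
  set g := rationalFourier σ a
  have hsq : ∀ z : ℝ≥0∞, z ^ (2 : ℝ) = z ^ 2 := fun z => by
    exact_mod_cast ENNReal.rpow_natCast z 2
  have hg : AEMeasurable (fun r : ℝ => g (-r)) (volume.restrict (Set.Ioi 0)) := by
    have hm : Measurable g := by
      refine Measurable.add ?_ ?_ <;> refine Finset.measurable_fun_sum _ fun k _ => ?_
      · exact (Measurable.indicator (by fun_prop) measurableSet_Iic).const_mul _
      · exact (Measurable.indicator (by fun_prop) measurableSet_Ioi).const_mul _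
    exact (hm.comp measurable_neg).aemeasurable
  have hpi : ‖(2 * Real.pi * Complex.I : ℂ)‖ₑ = ENNReal.ofReal (2 * Real.pi) := by
    rw [← ofReal_norm]
    simp [abs_of_pos Real.pi_pos]
  have hI : ∫⁻ r : ℝ in Set.Ioi 0, ‖g (-r)‖ₑ ^ 2 * ENNReal.ofReal r ≤ hDotHalfSq D := by
    rw [hpair.hDotHalfSq_eq]
    calc ∫⁻ r : ℝ in Set.Ioi 0, ‖g (-r)‖ₑ ^ 2 * ENNReal.ofReal r
        ≤ ∫⁻ r : ℝ in Set.Ioi 0, ‖g (-r)‖ₑ ^ 2 * ENNReal.ofReal |-r| := by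
          refine lintegral_mono fun r => ?_
          rw [abs_neg]
          gcongr
          exact le_abs_self r
      _ ≤ ∫⁻ r : ℝ, ‖g (-r)‖ₑ ^ 2 * ENNReal.ofReal |-r| := setLIntegral_le_lintegral _ _
      _ = ∫⁻ r : ℝ, ‖g r‖ₑ ^ 2 * ENNReal.ofReal |r| :=
          lintegral_neg_eq_self (fun r : ℝ => ‖g r‖ₑ ^ 2 * ENNReal.ofReal |r|)
      _ ≤ _ := by
          -- The factor 2π in the norm is at least 1 and is simply discarded.
          refine le_mul_of_one_le_left' ?_
          rw [ENNReal.one_le_ofReal]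
          linarith [Real.pi_gt_three]
  rw [sum_div_sq_eq_integral ha hζ, enorm_mul, hpi, halfPlaneWeight,
    mul_assoc (ENNReal.ofReal _)]
  refine mul_le_mul' le_rfl ?_
  calc _ ≤ ∫⁻ r : ℝ in Set.Ioi 0,
        ‖(r : ℂ) * Complex.exp (-(2 * Real.pi * Complex.I * ζ * r)) * g (-r)‖ₑ :=
        enorm_integral_le_lintegral_enorm _
    _ = ∫⁻ r : ℝ in Set.Ioi 0,
        ((fun r : ℝ => ENNReal.ofReal (√r * Real.exp (2 * Real.pi * ζ.im * r))) *
          fun r : ℝ => ENNReal.ofReal √r * ‖g (-r)‖ₑ) r := by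
        refine setLIntegral_congr_fun measurableSet_Ioi fun r hr => ?_
        have hr' : 0 ≤ r := le_of_lt hr
        rw [enorm_mul, Pi.mul_apply, ← mul_assoc, ← ENNReal.ofReal_mul (by positivity),
          ← ofReal_norm, norm_mul, Complex.norm_exp, Complex.norm_real, Real.norm_of_nonneg hr']
        congr 2
        have : (-(2 * Real.pi * Complex.I * ζ * r) : ℂ).re = 2 * Real.pi * ζ.im * r := by
          simp
        rw [this]
        nth_rewrite 1 [← Real.mul_self_sqrt hr']
        ring
    _ ≤ _ := ENNReal.lintegral_mul_le_Lp_mul_Lq _ Real.HolderConjugate.two_two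
        (by fun_prop) ((AEMeasurable.ennreal_ofReal (by fun_prop)).mul hg.enorm)
    _ ≤ _ := by
        refine mul_le_mul' (ENNReal.rpow_le_rpow (le_of_eq ?_) (by norm_num))
          (ENNReal.rpow_le_rpow (le_trans (le_of_eq ?_) hI) (by norm_num))
        · refine setLIntegral_congr_fun measurableSet_Ioi fun r hr => ?_
          have hr' : 0 ≤ r := le_of_lt hr
          simp only [hsq]
          rw [← ENNReal.ofReal_pow (by positivity), mul_pow, Real.sq_sqrt hr', ← Real.exp_nat_mul]
          congr 3
          push_cast
          ring
        · refine setLIntegral_congr_fun measurableSet_Ioi fun r hr => ?_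
          have hr' : 0 ≤ r := le_of_lt hr
          simp only [hsq]
          rw [mul_pow, ← ENNReal.ofReal_pow (by positivity), Real.sq_sqrt hr', mul_comm]

/-! ### From scattering to the travelling wave. -/

/-- The constant m₀ cancels in m - G, which becomes a rational function with 2N pairs of conjugate
poles: residues s_j at p_j and -c_k at y_k + vt in the upper half plane. -/
theorem tendsto_sum_div_sq {N : ℕ} {m : ℝ → ℝ → Fin 3 → ℝ} {m₀ : Fin 3 → ℝ}
    {s : Fin N → ℝ → Fin 3 → ℂ} {p : Fin N → ℝ → ℂ} (hm : IsRationalSolution m m₀ s p)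
    {v : ℝ} {c : Fin N → Fin 3 → ℂ} {y : Fin N → ℂ} (hy_im : ∀ j, 0 < (y j).im)
    (hscatter : Tendsto (fun t : ℝ => hDotHalfNorm
      (fun x i => (m t x i : ℂ) - rationalMap m₀ c y (x - t * v) i)) atTop (𝓝 0))
    {ζ : ℂ} (hζ : ζ.im < 0) (i : Fin 3) :
    Tendsto (fun t : ℝ => ∑ j, s j t i / (ζ - (p j t - v * t)) ^ 2) atTop
      (𝓝 (∑ k, c k i / (ζ - y k) ^ 2)) := by
  rw [tendsto_iff_edist_tendsto_0]
  have hbound : ∀ t : ℝ, edist (∑ j, s j t i / (ζ - (p j t - v * t)) ^ 2)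
      (∑ k, c k i / (ζ - y k) ^ 2) ≤ halfPlaneWeight ζ.im * hDotHalfNorm
        (fun x i => (m t x i : ℂ) - rationalMap m₀ c y (x - t * v) i) := fun t => by
    let σ : Fin N ⊕ Fin N → ℂ := Sum.elim (fun j => s j t i) (fun k => -c k i)
    let a : Fin N ⊕ Fin N → ℂ := Sum.elim (fun j => p j t) (fun k => y k + v * t)
    have ha : ∀ k, 0 < (a k).im := by
      rintro (j | k)
      · exact hm.pole_im_pos j t
      · simpa [a] using hy_im k
    have hD : ∀ x : ℝ, (m t x i : ℂ) - rationalMap m₀ c y (x - t * v) i =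
        ∑ k, σ k * ((x : ℂ) - a k)⁻¹ + ∑ k, conj (σ k) * ((x : ℂ) - conj (a k))⁻¹ := fun x => by
      have e1 : ∀ w : ℂ, (x : ℂ) - (w + v * t) = ((x - t * v : ℝ) : ℂ) - w := fun w => by
        push_cast
        ring
      rw [hm.rational]
      simp only [rationalMap, Fintype.sum_sum_type, σ, a, Sum.elim_inl, Sum.elim_inr, map_neg,
        map_add, map_mul, Complex.conj_ofReal, e1, neg_mul, Finset.sum_neg_distrib,
        div_eq_mul_inv]
      ring
    -- Shifting ζ by the real number vt passes to the moving frame and preserves Im ζ, so the weight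
    -- does not depend on t.
    have h := enorm_sum_div_sq_le ha (ζ := ζ + v * t) (by simpa using hζ) hD
    have e2 : (ζ + v * t).im = ζ.im := by simp
    rw [e2] at h
    rw [edist_eq_enorm_sub]
    have e3 : ∑ j, s j t i / (ζ - (p j t - v * t)) ^ 2 - ∑ k, c k i / (ζ - y k) ^ 2 =
        ∑ k, σ k / (ζ + v * t - a k) ^ 2 := by
      simp only [Fintype.sum_sum_type, σ, a, Sum.elim_inl, Sum.elim_inr, neg_div,
        Finset.sum_neg_distrib, sub_eq_add_neg, neg_add_rev, neg_neg]
      congr 1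
      · exact Finset.sum_congr rfl fun j _ => by ring
      · congr 1
        exact Finset.sum_congr rfl fun j _ => by ring
    rw [e3]
    refine h.trans (mul_le_mul' le_rfl (ENNReal.rpow_le_rpow ?_ (by norm_num)))
    exact Finset.single_le_sum (f := fun i => hDotHalfSq fun x : ℝ =>
      (m t x i : ℂ) - rationalMap m₀ c y (x - t * v) i) (fun _ _ => zero_le) (Finset.mem_univ i)
  refine tendsto_of_tendsto_of_tendsto_of_le_of_le tendsto_const_nhds ?_ (fun _ => zero_le)
    hbound
  simpa using ENNReal.Tendsto.const_mul hscatter (Or.inr (halfPlaneWeight_ne_top hζ))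

theorem IsRationalSolution.travelling {N : ℕ} {m : ℝ → ℝ → Fin 3 → ℝ} {m₀ : Fin 3 → ℝ}
    {s : Fin N → ℝ → Fin 3 → ℂ} {p : Fin N → ℝ → ℂ} (hm : IsRationalSolution m m₀ s p)
    {v : ℝ} {c : Fin N → Fin 3 → ℂ} {y : Fin N → ℂ}
    (hc : ∀ j, c j ≠ 0) (hy_im : ∀ j, 0 < (y j).im) (hy : Function.Injective y)
    (hscatter : Tendsto (fun t : ℝ => hDotHalfNorm
      (fun x i => (m t x i : ℂ) - rationalMap m₀ c y (x - t * v) i)) atTop (𝓝 0)) :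
    (∀ j t, p j t = p j 0 + v * t) ∧ (∀ j t, s j t = s j 0) ∧
      ∀ t j k, j ≠ k → s j t ⬝ᵥ s k t = 0 := by
  classical
  -- J consists of the indices whose spin is nonzero at time 0; `hJ` then rules out zero spins at
  -- all times.
  obtain ⟨hJ, φ, hφ, R, hR⟩ := poles_bounded_of_tendsto hy hy_im hc
    (Finset.univ.filter fun j => s j 0 ≠ 0)
    (z := fun n j => p j n - v * (n : ℝ)) (s := fun n j => s j n)
    (fun n j => by simpa using hm.pole_im_pos j n)
    (fun ζ hζ i => (tendsto_sum_div_sq hm hy_im hscatter hζ i).comp tendsto_natCast_atTop_atTop)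
    (fun n j hj => hm.spin_eq_zero (by simpa using hj) n)
  have hs : ∀ j t, s j t ≠ 0 := fun j t h => by
    have hj : j ∈ Finset.univ.filter fun j => s j 0 ≠ 0 := by
      rw [hJ]
      exact Finset.mem_univ j
    exact (Finset.mem_filter.1 hj).2 (hm.spin_eq_zero h 0)
  obtain ⟨h1, h2, h3⟩ := (hm.isSpinFlow hs).travelling
    (tendsto_natCast_atTop_atTop.comp hφ.tendsto_atTop) hR
  refine ⟨h1, fun j t => pauli_injective (h2 j t), fun t j k hjk => ?_⟩
  have h := pauli_mul_trace (s j t) (s k t)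
  rw [h3 t j k hjk, Matrix.trace_zero] at h
  simpa using h.symm

theorem mainTheorem6 {N : ℕ}
    (m : ℝ → ℝ → Fin 3 → ℝ) (m₀ : Fin 3 → ℝ)
    (s : Fin N → ℝ → Fin 3 → ℂ) (p : Fin N → ℝ → ℂ)
    (hm : IsRationalSolution m m₀ s p)
    (v : ℝ) (c : Fin N → Fin 3 → ℂ) (y : Fin N → ℂ)
    (hc : ∀ j, c j ≠ 0) (hy_im : ∀ j, 0 < (y j).im) (hy : Function.Injective y)
    (hscatter : Tendsto
      (fun t : ℝ => hDotHalfNorm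
        (fun x i => (m t x i : ℂ) - rationalMap m₀ c y (x - t * v) i))
      atTop (𝓝 0))
    (ε : Fin N → Fin N → ℤˣ) (ρ : Fin N → Fin N → ℝ → ℂ) (hρ : IsSpinRoot s ρ) :
    (∀ t x, m t x = m 0 (x - t * v)) ∧
      ∀ t, matsunoL ε ρ p t = (v : ℂ) • (1 : Matrix (Fin N) (Fin N) ℂ) ∧
        matsunoB ε ρ p t = 0 ∧
        HasDerivAt (matsunoX p) ((v : ℂ) • (1 : Matrix (Fin N) (Fin N) ℂ)) t ∧
        matsunoS ρ t = 0 := by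
  obtain ⟨hp, hs, hss⟩ := hm.travelling hc hy_im hy hscatter
  -- The only square root of 0 is 0, so the choices of roots and signs do not matter.
  have hroot : ∀ t i j, i ≠ j → ρ i j t = 0 := fun t i j hij => by
    have h := hρ i j t
    rw [hss t i j hij, mul_zero] at h
    exact pow_eq_zero_iff two_ne_zero |>.1 h
  have hderiv : ∀ j t, HasDerivAt (p j) v t := fun j t => by
    have h := ((hasDerivAt_id t).ofReal_comp.const_mul (v : ℂ)).const_add (p j 0)
    simp only [id_eq, Complex.ofReal_one, mul_one] at h
    rwa [← funext (hp j)] at h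
  refine ⟨fun t x => funext fun i => ?_, fun t => ⟨?_, ?_, ?_, ?_⟩⟩
  · have h : (m t x i : ℂ) = m 0 (x - t * v) i := by
      have e1 : ∀ w : ℂ, (x : ℂ) - (w + v * t) = ((x - t * v : ℝ) : ℂ) - w := fun w => by
        push_cast
        ring
      rw [hm.rational, hm.rational]
      simp only [rationalMap, hp _ t, hs _ t, map_add, map_mul, Complex.conj_ofReal, e1]
    exact_mod_cast h
  · ext i j
    by_cases hij : i = j
    · simp [matsunoL, hij, (hderiv j t).deriv]
    · simp [matsunoL, hij, hroot t i j hij]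
  · ext i j
    by_cases hij : i = j
    · simp [matsunoB, hij]
    · simp [matsunoB, hij, hroot t i j hij]
  · refine hasDerivAt_pi.2 fun i => hasDerivAt_pi.2 fun j => ?_
    by_cases hij : i = j
    · subst hij
      simpa [matsunoX] using hderiv i t
    · simpa [matsunoX, hij] using hasDerivAt_const t (0 : ℂ)
  · ext i j
    by_cases hij : i = j
    · simp [matsunoS, hij]
    · simp [matsunoS, hij, hroot t i j hij]
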